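/- Represent a $(0,1)$-sequence of length $n$ by the set $X\subseteq\{0,\dots,n-1\}$ of the positions of its ones; its weight is $|X|$, and its slot distances are the numbers $d=y-x-1$ for $x<y$ in $X$. Let $w_1<\dots<w_r$ be integers greater than $1$, $W=\{w_1,\dots,w_r\}$, and let $Q=(q_1,\dots,q_r)$ be a tuple of nonnegative rational numbers with sum $1$. An $(n,W,1,Q)$ nonconstant-weight strict optical orthogonal code (NCW-SOOC) is a nonempty finite set $\mathcal C$ of $(0,1)$-sequences of length $n$ with weights in $W$ such that: (1) for each $i$, the proportion of codewords of weight $w_i$ is $q_i$; (2) the slot distances of two different pairs $x<y$ and $x'<y'$ of positions of ones in the same codeword are different; (3) no slot distance of a codeword is equal to a slot distance of another codeword; (4) $n\ge 2D+3$, where $D$ is the maximum of all slot distances of all codewords. The code is *perfect* if $n\le n'$ for every $(n',W,1,Q)$-NCW-SOOC with the same number of codewords. It is *optimal* if no $(n,W,1,Q)$-NCW-SOOC has more codewords and $|\mathcal C|$ reaches the upper bound $\left\lfloor \frac{n-1}{\sum_i q_i w_i(w_i-1)}\right\rfloor$. **Corollary.** For every integer $g\ge 13$ with $g\equiv 1\pmod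 6$ there are a rational number $\theta$ with $\frac1{14}\le\theta\le 1$ and a $(g,\{3,4\},1,(1-\theta,\theta))$-NCW-SOOC (a proportion $1-\theta$ of the codewords has weight $3$ and a proportion $\theta$ has weight $4$) that is both perfect and optimal. -/

import Mathlib

/-- The parameters `d_{jk} = c_k - c_j - 1` of a codeword, for positions `c_j < c_k` of two of its
ones. -/
def slotDistance (p : ℕ × ℕ) : ℕ := p.2 - p.1 - 1

/-- The pairs `(c_j, c_k)` with `c_j < c_k` of positions of ones of the codeword `X`. -/
def positionPairs (X : Finset ℕ) : Finset (ℕ × ℕ) := (X ×ˢ X).filter fun p => p.1 < p.2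

/-- The maximum decoding slot distance `D` of a code. -/
def maxSlotDistance (C : Finset (Finset ℕ)) : ℕ :=
  C.sup fun X => (positionPairs X).sup slotDistance

/-- `C` is an `(n, {w 0, …, w (r-1)}, 1, (q 0, …, q (r-1)))` nonconstant-weight strict optical
orthogonal code. A `(0,1)`-sequence of length `n` is represented by the set of the positions
(in `{0, …, n-1}`) of its ones, so that its weight is the cardinality of that set. -/
structure IsSOOC (n : ℕ) {r : ℕ} (w : Fin r → ℕ) (q : Fin r → ℚ) (C : Finset (Finset ℕ)) :
    Prop where
  nonempty : C.Nonempty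
  length : ∀ X ∈ C, X ⊆ Finset.range n
  weight : ∀ X ∈ C, ∃ i, X.card = w i
  /-- the proportion of codewords of weight `w i` is `q i` -/
  distribution : ∀ i, ((C.filter fun X => X.card = w i).card : ℚ) / (C.card : ℚ) = q i
  auto : ∀ X ∈ C, ∀ p ∈ positionPairs X, ∀ p' ∈ positionPairs X, p ≠ p' →
    slotDistance p ≠ slotDistance p'
  cross : ∀ X ∈ C, ∀ Y ∈ C, X ≠ Y → ∀ p ∈ positionPairs X, ∀ p' ∈ positionPairs Y,
    slotDistance p ≠ slotDistance p'
  strict : 2 * maxSlotDistance C + 3 ≤ n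

/-- A code is perfect if its length is the minimum length of a code with the same number of
codewords, the same weights and the same weight distribution. -/
def IsPerfectSOOC (n : ℕ) {r : ℕ} (w : Fin r → ℕ) (q : Fin r → ℚ) (C : Finset (Finset ℕ)) :
    Prop :=
  IsSOOC n w q C ∧
    ∀ (n' : ℕ) (C' : Finset (Finset ℕ)), IsSOOC n' w q C' → C'.card = C.card → n ≤ n'

/-- A code is optimal if it has the maximum number of codewords among all codes with the same
length, weights and weight distribution, and this number moreover reaches the general upper bound
`⌊(n - 1) / ∑ q_i w_i (w_i - 1)⌋` (which is `⌊(n - 1) / (k (k - 1))⌋` if all weights are `k`). -/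
def IsOptimalSOOC (n : ℕ) {r : ℕ} (w : Fin r → ℕ) (q : Fin r → ℚ) (C : Finset (Finset ℕ)) :
    Prop :=
  IsSOOC n w q C ∧
    (∀ C' : Finset (Finset ℕ), IsSOOC n w q C' → C'.card ≤ C.card) ∧
    (C.card : ℤ) = ⌊((n : ℚ) - 1) / ∑ i, q i * (w i : ℚ) * ((w i : ℚ) - 1)⌋

/-! Call a position difference `y - x` of two ones a difference; it exceeds the slot distance by
one. A codeword of weight 3 has 3 differences and one of weight 4 has 6. In a code all of them are
distinct and lie in `1, …, D + 1`, and `2 * D + 3 ≤ n`, so twice the number of differences is at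
most `n - 1`; with proportions `1 - θ` and `θ` this reads `(6 + 6θ)|C| + 1 ≤ n`
(`IsSOOC.card_mul_le`). Equality makes a code both perfect and optimal. It holds once the
differences are exactly `1, …, N` and `n = 2 * N + 1`, so for `g = 6t + 1` it suffices to realise
`1, …, 3t` by triples and quadruples, each occurring once (`exists_code`).

Such families are built recursively (`exists_family_Ioc_six`). Inflation by 5 replaces each block by
five blocks and each difference `d` by the five numbers `5d - 2, …, 5d + 2` (`exists_inflate`). The
recursion realises `7, …, 3t` instead of `1, …, 3t`: inflating a family for `7, …, 3s` gives `33, …,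
15s + 2`, and a fixed extension pattern, uniform in `s`, supplies the missing `7, …, 32` together
with the next `40 + 3i` numbers (`exists_extension`). The result reaches `3(5s + i + 14)`, and `i =
0, …, 4` covers all residues modulo 5. Starting from explicit families for `16 ≤ t < 94`, this
reaches every `t ≥ 16`. The omitted `1, …, 6` are the differences of the single quadruple `0, 1, 4,
6`. The cases `2 ≤ t ≤ 15` are explicit.

For the bound on `θ`, the inequality `t ≤ 15|Q|` is carried through every step. Since `3t = 3|T| +
6|Q|`, it says `|T| ≤ 13|Q|`, that is `θ = |Q| / (|T| + |Q|) ≥ 1/14`. -/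

/-! ### Difference multisets of families of triples and quadruples -/

section Differences

variable {M N : Type*}

/-- The differences of the positions `0, a, a + b`. -/
def tripleDifferences [Add M] (b : M × M) : List M := [b.1, b.2, b.1 + b.2]

/-- The differences of the positions `0, a, a + b, a + b + c`. -/
def quadrupleDifferences [Add M] (b : M × M × M) : List M :=
  [b.1, b.2.1, b.2.2, b.1 + b.2.1, b.2.1 + b.2.2, b.1 + b.2.1 + b.2.2]

/-- All differences of a family of triples and quadruples, each given by its consecutive gaps. -/
def differences [Add M] (T : Multiset (M × M)) (Q : Multiset (M × M × M)) : Multiset M :=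
  T.bind (fun b => (tripleDifferences b : Multiset M)) +
    Q.bind (fun b => (quadrupleDifferences b : Multiset M))

theorem differences_add [Add M] (T T' : Multiset (M × M)) (Q Q' : Multiset (M × M × M)) :
    differences (T + T') (Q + Q') = differences T Q + differences T' Q' := by
  simp only [differences, Multiset.add_bind]
  abel

theorem differences_cons_left [Add M] (b : M × M) (T : Multiset (M × M))
    (Q : Multiset (M × M × M)) :
    differences (b ::ₘ T) Q = (tripleDifferences b : Multiset M) + differences T Q := by
  simp only [differences, Multiset.cons_bind, add_assoc]

theorem differences_cons_right [Add M] (b : M × M × M) (Q : Multiset (M × M × M)) :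
    differences 0 (b ::ₘ Q) = (quadrupleDifferences b : Multiset M) + differences 0 Q := by
  simp [differences]

/-- Differences are sums of gaps, so they commute with additive maps. This lets an identity with
symbolic parameters be decided once on coefficient vectors and then evaluated at arbitrary integers;
it also moves families from `ℕ` to `ℤ` and back. -/
theorem differences_map [AddZeroClass M] [AddZeroClass N] (f : M →+ N) (T : Multiset (M × M))
    (Q : Multiset (M × M × M)) :
    differences (T.map fun b => (f b.1, f b.2)) (Q.map fun b => (f b.1, f b.2.1, f b.2.2)) =
      (differences T Q).map f := by
  simp [differences, Multiset.bind_map, Multiset.map_bind, tripleDifferences, quadrupleDifferences]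

theorem differences_coe [Add M] (T : List (M × M)) (Q : List (M × M × M)) :
    differences (T : Multiset (M × M)) (Q : Multiset (M × M × M)) =
      (T.flatMap tripleDifferences ++ Q.flatMap quadrupleDifferences : List M) := by
  simp [differences, Multiset.coe_bind]

theorem card_differences [Add M] (T : Multiset (M × M)) (Q : Multiset (M × M × M)) :
    (differences T Q).card = 3 * T.card + 6 * Q.card := by
  simp [differences, Multiset.card_bind, tripleDifferences, quadrupleDifferences, mul_comm,
    Function.comp_def]

end Differences

/-! ### Inflation by 5 -/

section Inflation

/-- The homomorphism evaluating a formal combination of two gaps and a constant, the gaps being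
scaled by `5`. -/
def inflateHom₃ (a b : ℤ) : ℤ × ℤ × ℤ →+ ℤ where
  toFun x := 5 * a * x.1 + 5 * b * x.2.1 + x.2.2
  map_zero' := by simp
  map_add' x y := by simp; ring

/-- The homomorphism evaluating a formal combination of three gaps and a constant, the gaps being
scaled by `5`. -/
def inflateHom₄ (a b c : ℤ) : ℤ × ℤ × ℤ × ℤ →+ ℤ where
  toFun x := 5 * a * x.1 + 5 * b * x.2.1 + 5 * c * x.2.2.1 + x.2.2.2
  map_zero' := by simp
  map_add' x y := by simp; ring

theorem Icc_val_eq_map (d : ℤ) :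
    (Finset.Icc (5 * d - 2) (5 * d + 2)).val =
      (([-2, -1, 0, 1, 2] : List ℤ) : Multiset ℤ).map (5 * d + ·) := by
  refine (Multiset.Nodup.ext (Finset.nodup _) ?_).2 fun x => ?_
  · exact Multiset.Nodup.map (add_right_injective _) (by decide)
  · simp
    omega

theorem exists_inflate_triple (a b : ℤ) :
    ∃ T : Multiset (ℤ × ℤ), differences T 0 =
      (Finset.Icc (5 * a - 2) (5 * a + 2)).val + (Finset.Icc (5 * b - 2) (5 * b + 2)).val +
        (Finset.Icc (5 * (a + b) - 2) (5 * (a + b) + 2)).val := by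
  -- The constants `x` and `y` added to the two gaps each run through `-2, …, 2`, paired so that `x
  -- + y` does too, as integers and not merely modulo 5.
  let F : List ((ℤ × ℤ × ℤ) × (ℤ × ℤ × ℤ)) :=
    [((1, 0, -2), (0, 1, 0)), ((1, 0, -1), (0, 1, 1)), ((1, 0, 0), (0, 1, 2)),
      ((1, 0, 1), (0, 1, -2)), ((1, 0, 2), (0, 1, -1))]
  have key : differences (F : Multiset ((ℤ × ℤ × ℤ) × (ℤ × ℤ × ℤ))) 0 =
      ↑(([-2, -1, 0, 1, 2].map fun i => (1, 0, i)) ++ ([-2, -1, 0, 1, 2].map fun i => (0, 1, i)) ++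
        ([-2, -1, 0, 1, 2].map fun i => (1, 1, i)) : List (ℤ × ℤ × ℤ)) := by
    rw [← Multiset.coe_nil, differences_coe, Multiset.coe_eq_coe]
    decide
  refine ⟨(F : Multiset ((ℤ × ℤ × ℤ) × (ℤ × ℤ × ℤ))).map fun p => (inflateHom₃ a b p.1, inflateHom₃ a b p.2), ?_⟩
  have h := differences_map (inflateHom₃ a b) (F : Multiset ((ℤ × ℤ × ℤ) × (ℤ × ℤ × ℤ))) 0
  rw [Multiset.map_zero] at h
  rw [h, key]
  simp only [Icc_val_eq_map]
  simp [inflateHom₃, mul_add]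

theorem exists_inflate_quadruple (a b c : ℤ) :
    ∃ Q : Multiset (ℤ × ℤ × ℤ), Q.card = 5 ∧ differences 0 Q =
      (Finset.Icc (5 * a - 2) (5 * a + 2)).val + (Finset.Icc (5 * b - 2) (5 * b + 2)).val +
      (Finset.Icc (5 * c - 2) (5 * c + 2)).val +
      (Finset.Icc (5 * (a + b) - 2) (5 * (a + b) + 2)).val +
      (Finset.Icc (5 * (b + c) - 2) (5 * (b + c) + 2)).val +
      (Finset.Icc (5 * (a + b + c) - 2) (5 * (a + b + c) + 2)).val := by
  -- An additive sequence of permutations: each of `x`, `y`, `z`, `x + y`, `y + z`, `x + y + z` runs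
  -- through `-2, …, 2`.
  let F : List ((ℤ × ℤ × ℤ × ℤ) × (ℤ × ℤ × ℤ × ℤ) × (ℤ × ℤ × ℤ × ℤ)) :=
    [((1, 0, 0, -2), (0, 1, 0, 0), (0, 0, 1, 1)), ((1, 0, 0, -1), (0, 1, 0, 1), (0, 0, 1, -2)),
      ((1, 0, 0, 0), (0, 1, 0, 2), (0, 0, 1, 0)), ((1, 0, 0, 1), (0, 1, 0, -2), (0, 0, 1, 2)),
      ((1, 0, 0, 2), (0, 1, 0, -1), (0, 0, 1, -1))]
  have key : differences 0
      (F : Multiset ((ℤ × ℤ × ℤ × ℤ) × (ℤ × ℤ × ℤ × ℤ) × (ℤ × ℤ × ℤ × ℤ))) =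
      ↑(([-2, -1, 0, 1, 2].map fun i => (1, 0, 0, i)) ++
        ([-2, -1, 0, 1, 2].map fun i => (0, 1, 0, i)) ++
        ([-2, -1, 0, 1, 2].map fun i => (0, 0, 1, i)) ++
        ([-2, -1, 0, 1, 2].map fun i => (1, 1, 0, i)) ++
        ([-2, -1, 0, 1, 2].map fun i => (0, 1, 1, i)) ++
        ([-2, -1, 0, 1, 2].map fun i => (1, 1, 1, i)) : List (ℤ × ℤ × ℤ × ℤ)) := by
    rw [← Multiset.coe_nil, differences_coe, Multiset.coe_eq_coe]
    decide
  refine ⟨(F : Multiset ((ℤ × ℤ × ℤ × ℤ) × (ℤ × ℤ × ℤ × ℤ) × (ℤ × ℤ × ℤ × ℤ))).map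
    fun p =>
    (inflateHom₄ a b c p.1, inflateHom₄ a b c p.2.1, inflateHom₄ a b c p.2.2), by simp [F], ?_⟩
  have h := differences_map (inflateHom₄ a b c) 0
    (F : Multiset ((ℤ × ℤ × ℤ × ℤ) × (ℤ × ℤ × ℤ × ℤ) × (ℤ × ℤ × ℤ × ℤ)))
  rw [Multiset.map_zero] at h
  rw [h, key]
  simp only [Icc_val_eq_map]
  simp [inflateHom₄, mul_add]

/-- Inflation by `5`: every difference `d` is replaced by the interval `[5d - 2, 5d + 2]`. -/
theorem exists_inflate (T : Multiset (ℤ × ℤ)) (Q : Multiset (ℤ × ℤ × ℤ)) :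
    ∃ (T' : Multiset (ℤ × ℤ)) (Q' : Multiset (ℤ × ℤ × ℤ)), Q'.card = 5 * Q.card ∧
      differences T' Q' =
        (differences T Q).bind fun d => (Finset.Icc (5 * d - 2) (5 * d + 2)).val := by
  induction T using Multiset.induction with
  | empty =>
    induction Q using Multiset.induction with
    | empty => exact ⟨0, 0, by simp, by simp [differences]⟩
    | cons p Q ih =>
      obtain ⟨T', Q', hc, h⟩ := ih
      obtain ⟨Q'', hc', h'⟩ := exists_inflate_quadruple p.1 p.2.1 p.2.2
      refine ⟨0 + T', Q'' + Q', by simp [hc, hc']; ring, ?_⟩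
      rw [differences_add, h, h', differences_cons_right, Multiset.add_bind]
      simp [quadrupleDifferences, ← Multiset.cons_coe, add_assoc]
  | cons p T ih =>
    obtain ⟨T', Q', hc, h⟩ := ih
    obtain ⟨T'', h'⟩ := exists_inflate_triple p.1 p.2
    refine ⟨T'' + T', 0 + Q', by simp [hc], ?_⟩
    rw [differences_add, h, h', differences_cons_left, Multiset.add_bind]
    simp [tripleDifferences, ← Multiset.cons_coe, add_assoc]

/-- The intervals `[5d - 2, 5d + 2]` tile the integers: `x` lies in exactly the one with `d = ⌊(x +
2) / 5⌋`. -/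
theorem Ioc_bind_Icc (k N : ℤ) :
    ((Finset.Ioc k N).val.bind fun d => (Finset.Icc (5 * d - 2) (5 * d + 2)).val) =
      (Finset.Ioc (5 * k + 2) (5 * N + 2)).val := by
  have hd : (↑(Finset.Ioc k N) : Set ℤ).PairwiseDisjoint
      fun d : ℤ => Finset.Icc (5 * d - 2) (5 * d + 2) := by
    intro x _ y _ hxy
    refine Finset.disjoint_left.2 fun z hz hz' => hxy ?_
    simp only [Finset.mem_Icc] at hz hz'
    omega
  have := Finset.disjiUnion_val (Finset.Ioc k N)
    (fun d : ℤ => Finset.Icc (5 * d - 2) (5 * d + 2)) hd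
  rw [← this]
  congr 1
  ext x
  simp only [Finset.mem_disjiUnion, Finset.mem_Ioc, Finset.mem_Icc]
  constructor
  · rintro ⟨d, hd⟩
    omega
  · intro hx
    exact ⟨(x + 2) / 5, by omega⟩

theorem Ioc_val_add (a b c : ℤ) (hab : a ≤ b) (hbc : b ≤ c) :
    (Finset.Ioc a b).val + (Finset.Ioc b c).val = (Finset.Ioc a c).val := by
  have hd : Disjoint (Finset.Ioc a b) (Finset.Ioc b c) := by
    refine Finset.disjoint_left.2 fun z hz hz' => ?_
    simp only [Finset.mem_Ioc] at hz hz'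
    omega
  rw [← Finset.disjUnion_val _ _ hd]
  congr 1
  ext x
  simp only [Finset.mem_disjUnion, Finset.mem_Ioc]
  omega

end Inflation

/-! ### Extending an inflated family, uniformly in its upper end `L` -/

section Extension

/-- The homomorphism evaluating a formal sum of a multiple of `L` and a constant. -/
def evalHom (L : ℤ) : ℕ × ℕ →+ ℤ where
  toFun x := L * x.1 + x.2
  map_zero' := by simp
  map_add' x y := by simp; ring

theorem Ioc_val_eq_map (a : ℤ) (m n : ℕ) :
    (Finset.Ioc (a + m) (a + m + n)).val =
      ((List.range' (m + 1) n : List ℕ) : Multiset ℕ).map fun i : ℕ => a + (i : ℤ) := by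
  refine (Multiset.Nodup.ext (Finset.nodup _) ?_).2 fun x => ?_
  · exact Multiset.Nodup.map (fun i j h => by simpa using h) (by simp [List.nodup_range'])
  · simp only [Finset.mem_val, Finset.mem_Ioc, Multiset.mem_map, Multiset.mem_coe,
      List.mem_range'_1]
    constructor
    · intro h
      exact ⟨(x - a).toNat, by omega, by omega⟩
    · rintro ⟨i, hi, rfl⟩
      omega

/-- The families of triples and quadruples used below to prolong an inflated family: the entry with
index `i` has as its differences the numbers `7, …, 32` and `L + 1, …, L + 40 + 3 * i`. Here a pair
`(u, v)` stands for the number `L * u + v`. -/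
def extensions : List (List ((ℕ × ℕ) × (ℕ × ℕ)) × List ((ℕ × ℕ) × (ℕ × ℕ) × (ℕ × ℕ))) := [
  ([((0, 8), (1, 16)), ((0, 9), (1, 21)), ((0, 10), (0, 22)), ((0, 11), (1, 9)),
  ((0, 12), (1, 13)), ((0, 13), (0, 16)), ((0, 15), (1, 17)), ((0, 17), (1, 22)),
  ((0, 18), (1, 11)), ((0, 19), (1, 18)), ((0, 20), (1, 3)), ((0, 21), (1, 6)),
  ((0, 23), (1, 8)), ((0, 24), (1, 14)), ((0, 25), (1, 15)), ((0, 26), (1, 10)),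
  ((0, 27), (1, 1)), ((0, 28), (1, 7)), ((0, 30), (1, 4)), ((0, 31), (1, 2))],
   [((0, 7), (1, 5), (0, 14))]),
  ([((0, 7), (1, 16)), ((0, 9), (1, 30)), ((0, 16), (1, 13)), ((0, 18), (1, 10)),
  ((0, 20), (1, 14)), ((0, 23), (1, 2)), ((0, 25), (1, 17)), ((0, 26), (1, 5)),
  ((0, 27), (1, 6)), ((0, 28), (1, 15)), ((0, 29), (1, 12))],
   [((0, 10), (0, 21), (1, 1)), ((0, 11), (1, 8), (0, 19)), ((0, 12), (1, 9), (0, 15)),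
   ((0, 14), (1, 4), (0, 22)), ((0, 17), (0, 13), (1, 7)), ((0, 24), (0, 8), (1, 3))]),
  ([((0, 7), (1, 19)), ((0, 8), (1, 6)), ((0, 9), (1, 12)), ((0, 10), (1, 27)),
  ((0, 12), (1, 34)), ((0, 15), (1, 20)), ((0, 16), (1, 1)), ((0, 17), (1, 22)),
  ((0, 18), (1, 23)), ((0, 20), (1, 5)), ((0, 21), (1, 7)), ((0, 22), (1, 2)),
  ((0, 23), (1, 10)), ((0, 24), (1, 16)), ((0, 26), (1, 4)), ((0, 27), (1, 9)),
  ((0, 28), (1, 3)), ((0, 29), (1, 15)), ((0, 30), (1, 8)), ((0, 31), (1, 11))],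
   [((0, 13), (0, 19), (1, 13)), ((0, 14), (0, 11), (1, 18))]),
  ([((0, 9), (1, 14)), ((0, 21), (1, 18)), ((0, 24), (1, 9)), ((0, 25), (1, 6)),
  ((0, 26), (1, 12)), ((0, 29), (1, 15)), ((0, 30), (1, 16))],
   [((0, 7), (1, 4), (0, 31)), ((0, 8), (1, 28), (0, 12)), ((0, 10), (1, 7), (0, 15)),
   ((0, 11), (1, 2), (0, 32)), ((0, 13), (0, 14), (1, 10)), ((0, 16), (1, 5), (0, 20)),
   ((0, 17), (1, 3), (0, 23)), ((0, 18), (1, 1), (0, 28)), ((0, 19), (1, 8), (0, 22))]),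
  ([((0, 10), (1, 32)), ((0, 15), (1, 15)), ((0, 16), (1, 35)), ((0, 17), (1, 23)),
  ((0, 19), (1, 5)), ((0, 21), (1, 22)), ((0, 23), (1, 2)), ((0, 24), (1, 20)),
  ((0, 25), (1, 27)), ((0, 29), (1, 12)), ((0, 31), (1, 8)), ((0, 32), (1, 16))],
   [((0, 7), (1, 4), (0, 27)), ((0, 8), (1, 1), (0, 9)), ((0, 11), (1, 6), (0, 28)),
   ((0, 12), (1, 7), (0, 30)), ((0, 13), (1, 13), (0, 20)), ((0, 14), (1, 14), (0, 22)),
   ((0, 18), (1, 3), (0, 26))])]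

-- Equality of formal pairs `(u, v)` makes the pattern valid for every `L`. Since `L` has
-- coefficient 0 or 1 in each difference, at most one gap of a block involves it, and a block then
-- has at most two large differences per small one. The 26 small numbers `7, …, 32` thus allow at
-- most 52 large ones, which is attained at `i = 4`. This is why `1, …, 6` are left out: inflating a
-- family starting at 1 would leave only 1 and 2 as small numbers. The inequality is the share of `t
-- ≤ 15|Q|` belonging to the increment `i + 14` in `t = 5s + i + 14`.
set_option maxRecDepth 20000 in
theorem extensions_perm : ∀ i : Fin 5, ∃ p, extensions[i.val]? = some p ∧
    i.val + 14 ≤ 15 * p.2.length ∧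
    (p.1.flatMap tripleDifferences ++ p.2.flatMap quadrupleDifferences).Perm
      ((List.range' 7 26).map (fun j => (0, j)) ++
        (List.range' 1 (40 + 3 * i.val)).map fun j => (1, j)) := by
  intro i
  fin_cases i <;> exact ⟨_, rfl, by decide, List.isPerm_iff.1 (by decide)⟩

theorem exists_extension (i : ℕ) (hi : i < 5) (L : ℤ) :
    ∃ (T : Multiset (ℤ × ℤ)) (Q : Multiset (ℤ × ℤ × ℤ)), i + 14 ≤ 15 * Q.card ∧
      differences T Q =
        (Finset.Ioc 6 32).val + (Finset.Ioc L (L + (40 + 3 * i : ℕ))).val := by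
  obtain ⟨p, -, hq, hp⟩ := extensions_perm ⟨i, hi⟩
  have h := differences_map (evalHom L) (p.1 : Multiset ((ℕ × ℕ) × (ℕ × ℕ)))
    (p.2 : Multiset ((ℕ × ℕ) × (ℕ × ℕ) × (ℕ × ℕ)))
  refine ⟨_, _, ?_, h.trans ?_⟩
  · simpa using hq
  · rw [differences_coe, Multiset.coe_eq_coe.2 hp]
    have h₁ := Ioc_val_eq_map 0 6 26
    have h₂ := Ioc_val_eq_map L 0 (40 + 3 * i)
    norm_num at h₁ h₂
    push_cast
    rw [h₁, h₂, ← Multiset.coe_add, Multiset.map_add]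
    simp [evalHom, Function.comp_def]

end Extension

/-! ### Explicit families and their verification -/

section Families

/-- Whether the members of a list are distinct and none of them is the position of a binary digit
`1` of `m`. -/
def distinctFrom : ℕ → List ℕ → Bool
  | _, [] => true
  | m, d :: l => !m.testBit d && distinctFrom (m ||| 2 ^ d) l

/-- The number `m` is a bit mask of the values already seen, so the kernel does one bit test per
difference instead of pairwise comparisons. -/
theorem nodup_of_distinctFrom (l : List ℕ) (m : ℕ) (h : distinctFrom m l = true) :
    l.Nodup ∧ ∀ d ∈ l, m.testBit d = false := by
  induction l generalizing m with
  | nil => simp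
  | cons d l ih =>
    simp only [distinctFrom, Bool.and_eq_true, Bool.not_eq_true'] at h
    obtain ⟨hnd, hl⟩ := ih _ h.2
    simp only [Nat.testBit_or, Nat.testBit_two_pow, Bool.or_eq_false_iff,
      decide_eq_false_iff_not] at hl
    refine ⟨List.nodup_cons.2 ⟨fun hd => (hl d hd).2 rfl, hnd⟩, fun x hx => ?_⟩
    rcases List.mem_cons.1 hx with rfl | hx
    · exact h.1
    · exact (hl x hx).1

/-- Whether `p` is a family of triples and quadruples with differences `k + 1, …, N`, containing
sufficiently many quadruples. -/
def checkFamily (k N : ℕ) (p : List (ℕ × ℕ) × List (ℕ × ℕ × ℕ)) : Bool :=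
  let l := p.1.flatMap tripleDifferences ++ p.2.flatMap quadrupleDifferences
  distinctFrom 0 l && l.all (fun d => decide (k < d) && decide (d ≤ N)) &&
    decide (N - k ≤ l.length) && decide (N ≤ 45 * p.2.length)

/-- The entry with index `i` has the differences `1, …, 3 * (i + 2)`. -/
def smallFamilies : List (List (ℕ × ℕ) × List (ℕ × ℕ × ℕ)) := [
  ([],
   [(1, 3, 2)]),
  ([(1, 7)],
   [(3, 2, 4)]),
  ([(1, 10), (2, 6)],
   [(3, 4, 5)]),
  ([(2, 12), (5, 8), (6, 9)],
   [(1, 3, 7)]),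
  ([(4, 7), (5, 13), (6, 10), (8, 9)],
   [(1, 2, 12)]),
  ([(4, 15), (5, 16), (6, 14), (7, 11), (8, 9)],
   [(1, 2, 10)]),
  ([(1, 19), (3, 21), (6, 10), (7, 8)],
   [(4, 13, 5), (9, 2, 12)]),
  ([(4, 20), (6, 10), (7, 18), (8, 13), (9, 14)],
   [(1, 11, 15), (3, 2, 17)]),
  ([(1, 14), (3, 13), (5, 21), (9, 19)],
   [(2, 23, 4), (6, 11, 7), (8, 12, 10)]),
  ([(1, 22), (7, 9), (12, 19), (13, 17), (14, 18)],
   [(2, 24, 3), (5, 20, 8), (6, 4, 11)]),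
  ([(1, 21), (2, 32), (5, 28), (8, 17), (13, 23), (14, 16)],
   [(3, 7, 19), (4, 20, 11), (9, 6, 12)]),
  ([(1, 21), (2, 32), (3, 27), (4, 35), (8, 16), (9, 10), (12, 26)],
   [(5, 15, 13), (6, 17, 14), (7, 18, 11)]),
  ([(1, 39), (3, 23), (6, 14), (15, 21)],
   [(2, 29, 4), (8, 22, 12), (9, 7, 25), (10, 17, 11), (13, 5, 19)]),
  ([(1, 3), (5, 38), (6, 29), (7, 23), (8, 36), (9, 33), (10, 21), (14, 25), (15, 26), (17, 28),
  (18, 19)],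
   [(2, 20, 12), (13, 11, 16)])]

set_option maxRecDepth 10000 in
/-- The entry with index `i` has the differences `7, …, 3 * (i + 16)`. -/
def initialFamilies : List (List (ℕ × ℕ) × List (ℕ × ℕ × ℕ)) := [
  ([(7, 28), (8, 33), (9, 30), (11, 31), (14, 29), (15, 23), (17, 27), (18, 22), (19, 26),
  (21, 25)],
   [(10, 24, 13), (12, 20, 16)]),
  ([(10, 28), (12, 39), (13, 35), (14, 27), (15, 32), (16, 34), (17, 23), (18, 25), (19, 30),
  (20, 26), (21, 24)],
   [(7, 29, 8), (9, 22, 11)]),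
  ([(7, 39), (9, 41), (10, 28), (12, 33), (15, 27), (16, 36), (17, 20), (18, 29), (19, 25),
  (22, 31), (23, 26), (24, 30)],
   [(8, 32, 11), (13, 21, 14)]),
  ([(7, 40), (9, 44), (10, 38), (13, 30), (15, 31), (16, 29), (18, 39), (19, 36), (22, 34),
  (24, 27), (26, 28)],
   [(8, 25, 17), (11, 21, 20), (12, 23, 14)]),
  ([(9, 41), (10, 37), (11, 40), (12, 44), (13, 35), (14, 39), (16, 27), (17, 32), (18, 42),
  (20, 25), (21, 34), (22, 36), (24, 30), (28, 29)],
   [(7, 19, 33), (8, 23, 15)]),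
  ([(7, 47), (9, 34), (10, 41), (13, 31), (14, 45), (16, 30), (17, 40), (19, 39), (21, 42),
  (22, 26), (23, 32), (25, 37), (27, 29)],
   [(8, 28, 24), (11, 38, 12), (18, 15, 20)]),
  ([(7, 49), (8, 46), (16, 26), (17, 43), (18, 48), (19, 44), (20, 39), (21, 32), (22, 35),
  (23, 27), (28, 36), (30, 31)],
   [(10, 41, 14), (11, 34, 13), (12, 25, 15), (24, 9, 29)]),
  ([(7, 57), (8, 36), (9, 56), (10, 41), (12, 50), (14, 40), (15, 46), (16, 37), (17, 43),
  (19, 39), (24, 42), (25, 27), (28, 35), (29, 30), (33, 34)],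
   [(11, 20, 18), (13, 32, 23), (21, 26, 22)]),
  ([(8, 50), (9, 53), (11, 48), (12, 42), (16, 49), (18, 46), (20, 37), (21, 35), (22, 45),
  (23, 29), (25, 38), (27, 44)],
   [(7, 33, 28), (10, 24, 36), (15, 32, 19), (17, 14, 41), (26, 13, 30)]),
  ([(7, 50), (8, 46), (9, 51), (10, 64), (11, 41), (12, 61), (14, 53), (16, 56), (17, 45),
  (19, 39), (21, 47), (22, 27), (23, 25), (24, 42), (26, 43), (29, 34), (30, 40), (32, 33),
  (35, 36)],
   [(15, 13, 31), (20, 18, 37)]),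
  ([(8, 44), (9, 60), (10, 45), (12, 58), (13, 50), (14, 23), (15, 51), (16, 56), (17, 47),
  (18, 53), (20, 54), (22, 39), (24, 49), (26, 41), (27, 48), (28, 40), (29, 33), (30, 35),
  (31, 46), (34, 42)],
   [(7, 25, 11), (19, 38, 21)]),
  ([(7, 54), (8, 26), (9, 57), (10, 64), (11, 47), (13, 63), (14, 51), (17, 53), (18, 38),
  (20, 49), (21, 52), (22, 55), (23, 37), (25, 50), (27, 41), (31, 48), (32, 40), (33, 45),
  (36, 44)],
   [(12, 30, 29), (19, 16, 46), (24, 15, 28)]),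
  ([(7, 62), (8, 63), (11, 56), (13, 39), (16, 68), (17, 43), (18, 41), (19, 46), (22, 36),
  (25, 49), (26, 51), (29, 37), (31, 47), (34, 42)],
   [(9, 24, 48), (10, 45, 28), (12, 38, 32), (14, 40, 21), (15, 20, 44), (23, 30, 27)]),
  ([(8, 72), (10, 42), (11, 45), (13, 44), (14, 51), (18, 66), (19, 49), (20, 58), (21, 29),
  (22, 53), (23, 60), (25, 48), (27, 47), (28, 36), (31, 32), (34, 43), (40, 41)],
   [(7, 62, 17), (12, 55, 15), (16, 38, 33), (24, 35, 26), (30, 9, 37)]),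
  ([(8, 81), (10, 47), (11, 63), (12, 52), (16, 54), (17, 61), (20, 51), (21, 65), (25, 44),
  (26, 50), (28, 49), (34, 45), (35, 38), (37, 46)],
   [(9, 39, 36), (13, 30, 42), (15, 14, 53), (18, 40, 22), (19, 41, 27), (24, 7, 59),
   (32, 23, 33)]),
  ([(9, 68), (10, 78), (11, 39), (12, 81), (13, 58), (14, 46), (16, 63), (17, 66), (18, 43),
  (19, 65), (20, 52), (21, 53), (22, 69), (23, 62), (24, 30), (25, 67), (26, 44), (28, 59),
  (29, 51), (31, 33), (34, 56), (35, 38), (36, 40)],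
   [(7, 48, 27), (32, 15, 42), (37, 8, 41)]),
  ([(8, 50), (10, 60), (13, 63), (14, 66), (15, 74), (17, 79), (20, 61), (22, 40), (23, 41),
  (25, 52), (32, 59), (33, 38), (34, 44), (42, 45)],
   [(7, 75, 11), (12, 53, 30), (16, 35, 37), (18, 36, 31), (19, 49, 24), (21, 26, 43),
   (27, 29, 28), (39, 9, 46)]),
  ([(7, 89), (8, 48), (9, 71), (10, 77), (11, 73), (12, 53), (13, 68), (15, 67), (16, 75),
  (18, 41), (20, 63), (22, 32), (23, 62), (26, 66), (29, 70), (30, 42), (34, 52), (35, 55),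
  (37, 61), (44, 50), (46, 47)],
   [(14, 31, 43), (17, 40, 38), (19, 39, 21), (25, 24, 27), (28, 36, 33)]),
  ([(7, 73), (8, 89), (9, 75), (10, 77), (14, 72), (16, 51), (17, 54), (19, 64), (22, 66),
  (24, 74), (26, 76), (27, 69), (29, 65), (31, 61), (33, 49), (34, 59), (36, 43), (38, 52),
  (39, 56), (44, 47)],
   [(12, 18, 40), (15, 35, 28), (20, 21, 60), (23, 25, 37), (32, 13, 55), (42, 11, 46)]),
  ([(7, 34), (10, 83), (11, 58), (13, 52), (14, 60), (15, 79), (16, 71), (17, 56), (18, 59),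
  (19, 86), (22, 45), (24, 61), (25, 57), (26, 78), (27, 54), (30, 42), (31, 70), (32, 48),
  (33, 66), (35, 63), (36, 64), (37, 53), (38, 51), (40, 44), (43, 49), (46, 50), (47, 55)],
   [(8, 20, 75), (9, 12, 76), (23, 39, 29)]),
  ([(7, 72), (8, 94), (10, 59), (12, 96), (17, 51), (18, 81), (19, 47), (20, 57), (22, 60),
  (23, 78), (24, 63), (25, 75), (26, 45), (29, 61), (30, 32), (31, 39), (33, 73), (34, 52),
  (35, 56), (36, 49), (40, 58), (41, 54), (42, 65), (43, 50)],
   [(9, 74, 14), (11, 44, 48), (15, 13, 76), (16, 37, 27), (21, 46, 38)]),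
  ([(9, 77), (11, 62), (15, 72), (17, 94), (19, 39), (20, 50), (21, 85), (23, 66), (24, 79),
  (25, 55), (27, 71), (31, 78), (32, 60), (33, 68), (36, 63), (37, 51), (38, 53), (41, 59),
  (42, 48)],
   [(8, 75, 22), (12, 40, 44), (13, 69, 26), (14, 29, 64), (16, 18, 47), (28, 46, 30),
   (35, 10, 57), (49, 7, 54)]),
  ([(7, 59), (8, 64), (9, 65), (11, 60), (12, 80), (13, 81), (15, 86), (17, 87), (19, 90),
  (23, 73), (25, 70), (27, 79), (31, 54), (32, 82), (35, 76), (36, 61), (38, 75), (39, 68),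
  (40, 63), (41, 67), (42, 47), (43, 62), (44, 49), (45, 46), (48, 51), (50, 52)],
   [(10, 78, 22), (14, 69, 29), (18, 16, 21), (20, 33, 24), (26, 30, 28)]),
  ([(13, 76), (14, 87), (15, 98), (17, 44), (19, 80), (20, 83), (21, 70), (25, 48), (26, 67),
  (29, 71), (30, 60), (31, 66), (38, 56), (43, 62), (49, 58), (51, 55), (57, 59)],
   [(8, 37, 47), (9, 7, 95), (10, 68, 36), (11, 42, 35), (12, 69, 27), (23, 52, 34),
   (28, 18, 64), (32, 22, 63), (33, 39, 40), (41, 24, 50)]),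
  ([(7, 66), (8, 83), (10, 109), (11, 58), (13, 90), (14, 97), (16, 84), (17, 101), (22, 40),
  (24, 61), (26, 86), (28, 70), (29, 46), (30, 51), (34, 43), (35, 71), (36, 74), (38, 78),
  (39, 68), (42, 63), (45, 59), (47, 49), (55, 60), (56, 64)],
   [(9, 79, 20), (12, 53, 27), (15, 33, 54), (18, 19, 76), (21, 31, 41), (23, 44, 50),
   (25, 57, 32)]),
  ([(9, 62), (10, 42), (11, 103), (12, 57), (14, 97), (18, 70), (19, 98), (20, 82), (21, 92),
  (22, 72), (23, 78), (24, 85), (25, 75), (26, 27), (28, 68), (29, 66), (33, 77), (34, 47),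
  (35, 86), (37, 46), (38, 67), (43, 65), (45, 59), (55, 64), (56, 60)],
   [(8, 99, 16), (13, 50, 30), (15, 74, 17), (31, 48, 39), (32, 41, 49), (36, 40, 44),
   (51, 7, 54)]),
  ([(7, 66), (8, 16), (9, 41), (10, 96), (11, 89), (12, 44), (13, 54), (14, 90), (15, 93),
  (19, 76), (20, 98), (21, 84), (22, 77), (25, 87), (26, 71), (27, 58), (28, 55), (29, 92),
  (30, 81), (31, 91), (32, 94), (33, 68), (35, 75), (36, 52), (39, 78), (40, 79), (45, 70),
  (47, 69), (48, 61), (49, 53), (51, 62), (59, 65)],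
   [(17, 57, 46), (18, 64, 43), (34, 38, 42), (37, 23, 63)]),
  ([(7, 121), (9, 107), (10, 115), (11, 98), (14, 42), (15, 114), (16, 30), (17, 74), (19, 82),
  (20, 103), (21, 44), (22, 62), (23, 67), (24, 73), (25, 95), (27, 81), (28, 57), (29, 60),
  (31, 71), (32, 94), (33, 66), (34, 49), (35, 75), (36, 68), (37, 80), (38, 86), (40, 72),
  (41, 77), (43, 50), (45, 61), (47, 58), (48, 63), (53, 69), (54, 59), (55, 64)],
   [(8, 79, 13), (18, 52, 26), (39, 12, 76)]),
  ([(7, 107), (8, 103), (10, 77), (12, 105), (13, 66), (14, 98), (15, 115), (17, 106), (18, 82),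
  (19, 101), (20, 71), (22, 96), (23, 62), (29, 84), (30, 56), (32, 43), (33, 59), (36, 44),
  (38, 78), (40, 50), (41, 53), (42, 67), (45, 52), (46, 81), (48, 74), (51, 70), (57, 68),
  (58, 73), (60, 69), (63, 65)],
   [(16, 9, 99), (24, 64, 31), (26, 21, 55), (27, 34, 49), (28, 11, 93), (37, 35, 54)]),
  ([(8, 109), (9, 115), (19, 82), (20, 59), (21, 86), (23, 69), (24, 78), (25, 80), (26, 100),
  (27, 63), (30, 103), (31, 68), (33, 89), (34, 60), (35, 81), (38, 70), (39, 71), (40, 85),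
  (44, 74), (45, 75), (47, 88), (48, 50), (49, 62), (56, 67), (58, 61)],
   [(10, 12, 65), (11, 42, 51), (13, 15, 106), (16, 36, 76), (17, 96, 18), (32, 14, 83),
   (37, 54, 41), (43, 29, 55), (57, 7, 66)]),
  ([(7, 84), (8, 105), (10, 115), (11, 108), (12, 66), (14, 65), (16, 122), (17, 50), (19, 57),
  (20, 104), (21, 38), (22, 81), (23, 112), (24, 87), (25, 89), (26, 101), (28, 62), (30, 88),
  (31, 85), (32, 99), (33, 63), (34, 98), (35, 95), (36, 71), (39, 97), (40, 70), (41, 53),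
  (42, 92), (43, 86), (45, 72), (46, 56), (48, 80), (49, 77), (51, 55), (54, 69), (58, 75)],
   [(9, 18, 82), (37, 15, 68), (44, 29, 64), (47, 13, 61)]),
  ([(7, 88), (8, 74), (10, 108), (11, 116), (12, 126), (13, 91), (14, 107), (15, 62), (16, 36),
  (22, 51), (24, 89), (25, 99), (28, 81), (29, 65), (30, 90), (32, 96), (33, 64), (34, 100),
  (39, 84), (40, 101), (42, 98), (43, 76), (47, 75), (48, 63), (50, 67), (53, 72), (54, 60),
  (57, 79), (59, 70), (61, 69), (66, 71)],
   [(9, 35, 68), (18, 23, 92), (20, 58, 27), (21, 17, 93), (26, 19, 87), (37, 46, 56),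
   (49, 31, 55)]),
  ([(7, 95), (8, 91), (9, 43), (10, 129), (11, 103), (12, 76), (13, 106), (14, 123), (17, 121),
  (19, 77), (20, 69), (21, 64), (24, 26), (27, 107), (28, 80), (29, 72), (30, 54), (32, 83),
  (33, 94), (34, 71), (35, 97), (36, 104), (37, 87), (38, 60), (39, 92), (40, 70), (41, 79),
  (42, 58), (44, 81), (46, 65), (47, 86), (48, 61), (51, 75), (53, 63), (55, 67), (57, 73),
  (59, 82), (66, 78)],
   [(15, 16, 112), (18, 56, 62), (22, 23, 90), (25, 68, 49)]),
  ([(8, 136), (10, 99), (11, 128), (13, 61), (14, 104), (16, 69), (17, 30), (18, 98), (20, 90),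
  (21, 100), (23, 78), (24, 60), (26, 117), (28, 112), (29, 95), (31, 55), (32, 71), (33, 105),
  (34, 48), (35, 111), (36, 77), (37, 96), (38, 41), (39, 102), (40, 57), (42, 50), (44, 76),
  (45, 80), (52, 83), (53, 73), (54, 88), (56, 91), (58, 87), (59, 68), (62, 75), (63, 67),
  (64, 70)],
   [(7, 107, 15), (9, 72, 51), (12, 94, 25), (19, 46, 43), (22, 27, 66)]),
  ([(7, 101), (10, 111), (12, 119), (14, 118), (15, 82), (16, 107), (17, 110), (18, 102),
  (19, 124), (22, 94), (25, 117), (37, 93), (43, 70), (46, 49), (51, 77), (56, 90), (58, 81),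
  (62, 78), (63, 75), (64, 84)],
   [(8, 80, 34), (11, 61, 73), (13, 112, 24), (20, 86, 29), (21, 53, 76), (23, 27, 41),
   (26, 39, 40), (28, 38, 60), (30, 59, 44), (32, 67, 42), (33, 36, 35), (47, 45, 55),
   (48, 9, 87), (52, 31, 54)]),
  ([(7, 115), (8, 112), (9, 143), (10, 108), (11, 65), (14, 127), (17, 83), (18, 92), (19, 72),
  (20, 24), (21, 128), (22, 89), (23, 98), (25, 42), (26, 103), (27, 70), (28, 123), (29, 34),
  (32, 85), (33, 104), (35, 58), (36, 88), (37, 107), (38, 94), (39, 114), (40, 62), (41, 60),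
  (43, 73), (45, 64), (47, 86), (48, 82), (50, 56), (51, 84), (52, 95), (53, 66), (55, 87),
  (57, 74), (59, 81), (61, 78), (68, 77), (71, 75)],
   [(12, 113, 13), (16, 80, 54), (31, 15, 90), (49, 30, 69)]),
  ([(7, 85), (8, 100), (10, 130), (11, 53), (13, 105), (14, 89), (15, 81), (18, 39), (20, 78),
  (21, 112), (22, 80), (23, 109), (24, 128), (26, 123), (28, 116), (29, 117), (30, 115),
  (32, 59), (34, 97), (35, 69), (37, 119), (38, 46), (42, 87), (43, 79), (44, 111), (48, 99),
  (49, 52), (50, 76), (54, 83), (56, 65), (60, 90), (61, 75), (66, 72), (67, 86), (68, 74),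
  (71, 77)],
   [(9, 27, 107), (12, 82, 45), (16, 47, 88), (17, 93, 31), (19, 51, 55), (25, 33, 62),
   (40, 73, 41)]),
  ([(7, 138), (8, 63), (10, 105), (11, 61), (13, 39), (14, 144), (16, 98), (17, 131), (18, 112),
  (19, 117), (20, 73), (21, 106), (22, 70), (23, 88), (24, 94), (25, 103), (26, 87), (27, 126),
  (28, 122), (29, 49), (30, 69), (32, 53), (34, 125), (35, 97), (37, 104), (38, 82), (40, 89),
  (41, 68), (42, 110), (43, 80), (44, 64), (45, 79), (47, 95), (50, 83), (51, 86), (54, 102),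
  (56, 65), (58, 96), (60, 75), (62, 77), (66, 74), (67, 84), (76, 81)],
   [(12, 107, 36), (15, 33, 101), (31, 59, 57), (46, 9, 91)]),
  ([(7, 152), (9, 107), (10, 91), (11, 31), (12, 128), (13, 134), (14, 104), (15, 90), (16, 145),
  (17, 119), (18, 103), (20, 137), (21, 88), (22, 93), (23, 131), (27, 38), (28, 120), (30, 78),
  (32, 124), (33, 96), (34, 79), (35, 75), (36, 64), (39, 87), (40, 111), (41, 53), (43, 89),
  (44, 114), (45, 72), (46, 95), (47, 99), (49, 81), (51, 71), (52, 97), (54, 69), (55, 98),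
  (56, 83), (57, 70), (58, 80), (59, 85), (61, 74), (63, 92), (66, 67), (76, 84)],
   [(8, 60, 82), (19, 106, 37), (25, 48, 29), (26, 24, 62)]),
  ([(8, 153), (10, 106), (11, 128), (14, 79), (15, 103), (16, 96), (17, 129), (21, 127),
  (23, 75), (26, 124), (28, 117), (29, 125), (32, 72), (33, 90), (34, 55), (35, 114), (36, 100),
  (38, 84), (40, 80), (41, 46), (42, 67), (44, 69), (45, 74), (47, 63), (48, 59), (49, 92),
  (50, 81), (52, 83), (53, 85), (54, 101), (56, 102), (58, 82), (62, 64), (65, 68), (76, 88)],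
   [(7, 144, 12), (9, 57, 86), (13, 108, 39), (18, 19, 78), (20, 31, 111), (22, 77, 60),
   (25, 105, 27), (43, 30, 61), (70, 24, 71)]),
  ([(7, 88), (8, 125), (9, 103), (10, 151), (12, 93), (14, 80), (15, 41), (16, 108), (17, 114),
  (18, 64), (19, 72), (20, 109), (21, 146), (22, 127), (23, 145), (26, 100), (27, 138),
  (28, 115), (29, 110), (30, 122), (31, 119), (33, 99), (34, 62), (35, 113), (38, 104),
  (40, 117), (42, 121), (43, 63), (45, 78), (46, 89), (47, 107), (49, 52), (50, 87), (51, 77),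
  (53, 58), (54, 90), (55, 75), (57, 102), (60, 98), (66, 74), (67, 86), (68, 73), (71, 85),
  (81, 83)],
   [(13, 11, 136), (32, 65, 69), (36, 25, 59), (39, 37, 79), (44, 48, 70)]),
  ([(7, 90), (9, 43), (11, 134), (12, 125), (14, 128), (16, 138), (18, 40), (19, 101), (20, 132),
  (21, 123), (23, 96), (24, 102), (25, 105), (26, 78), (27, 113), (28, 94), (29, 117), (30, 103),
  (31, 77), (32, 107), (35, 115), (36, 135), (37, 116), (39, 127), (41, 121), (45, 65), (46, 72),
  (49, 63), (53, 83), (54, 75), (55, 92), (56, 111), (57, 98), (59, 106), (60, 100), (62, 89),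
  (64, 84), (67, 91), (68, 81), (69, 88), (71, 99), (73, 95), (74, 85)],
   [(8, 79, 82), (10, 51, 15), (13, 34, 109), (22, 48, 93), (33, 17, 114), (38, 42, 44)]),
  ([(8, 160), (9, 157), (11, 110), (12, 140), (14, 71), (15, 82), (16, 154), (17, 148),
  (18, 120), (19, 88), (20, 117), (21, 101), (22, 80), (23, 104), (27, 145), (28, 46), (32, 84),
  (33, 92), (34, 112), (36, 106), (37, 113), (39, 119), (40, 109), (41, 100), (43, 130),
  (44, 91), (47, 79), (49, 94), (50, 111), (51, 96), (52, 103), (53, 98), (54, 61), (55, 73),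
  (56, 58), (59, 77), (69, 70), (78, 93)],
   [(10, 89, 75), (13, 131, 25), (26, 42, 66), (29, 38, 95), (30, 60, 63), (31, 87, 45),
   (35, 48, 76), (57, 7, 65), (62, 24, 81)]),
  ([(8, 149), (9, 121), (10, 79), (11, 151), (12, 61), (13, 119), (14, 161), (15, 126),
  (16, 155), (17, 133), (18, 135), (19, 109), (21, 97), (26, 148), (27, 81), (28, 106),
  (29, 143), (30, 138), (32, 92), (33, 144), (34, 67), (36, 110), (37, 94), (38, 87), (39, 60),
  (42, 78), (43, 68), (44, 103), (47, 129), (48, 74), (51, 53), (52, 102), (54, 82), (55, 85),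
  (56, 113), (58, 98), (59, 107), (62, 83), (64, 88), (69, 91), (77, 93)],
   [(7, 65, 40), (22, 23, 114), (24, 76, 63), (25, 46, 96), (31, 86, 41), (49, 35, 80),
   (50, 66, 57), (70, 20, 75)]),
  ([(8, 137), (9, 135), (10, 163), (11, 149), (13, 157), (14, 154), (15, 92), (17, 158),
  (19, 131), (21, 91), (22, 118), (24, 117), (25, 95), (26, 136), (28, 100), (31, 134),
  (32, 110), (33, 133), (34, 119), (35, 76), (38, 121), (39, 65), (41, 83), (42, 125), (43, 70),
  (45, 93), (48, 79), (49, 97), (52, 96), (55, 60), (56, 123), (57, 98), (58, 116), (61, 86),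
  (63, 88), (68, 71), (74, 82), (77, 103), (80, 81), (84, 85)],
   [(7, 102, 69), (12, 89, 75), (18, 36, 72), (20, 44, 50), (27, 46, 59), (29, 37, 106),
   (30, 23, 99), (47, 40, 90), (51, 16, 62)]),
  ([(7, 135), (8, 68), (9, 132), (10, 140), (11, 93), (12, 162), (15, 80), (16, 165), (17, 151),
  (23, 115), (24, 42), (26, 110), (28, 129), (29, 147), (30, 149), (31, 128), (32, 47), (34, 97),
  (35, 85), (36, 122), (37, 87), (38, 144), (39, 107), (40, 112), (41, 113), (44, 75), (45, 94),
  (46, 109), (48, 82), (50, 103), (51, 116), (52, 121), (53, 81), (54, 102), (58, 108), (61, 99),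
  (62, 118), (63, 101), (64, 69), (65, 106), (71, 90), (74, 89), (83, 92)],
   [(13, 114, 56), (14, 59, 25), (18, 70, 55), (20, 57, 60), (21, 22, 126), (27, 96, 49),
   (67, 33, 78), (72, 19, 86)]),
  ([(7, 160), (8, 136), (10, 110), (11, 150), (12, 115), (14, 170), (15, 51), (16, 135),
  (17, 116), (22, 132), (23, 91), (24, 153), (25, 97), (27, 146), (28, 70), (29, 140), (30, 94),
  (31, 141), (32, 72), (34, 53), (35, 103), (36, 142), (40, 134), (41, 71), (42, 113), (43, 82),
  (44, 101), (45, 137), (46, 65), (49, 131), (50, 68), (52, 78), (54, 95), (55, 128), (56, 119),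
  (57, 106), (58, 99), (59, 67), (60, 92), (62, 77), (63, 108), (69, 107), (73, 85), (74, 88),
  (75, 84), (76, 89), (80, 105), (81, 83), (86, 93), (90, 96)],
   [(9, 39, 61), (13, 20, 123), (18, 19, 129), (21, 26, 121), (64, 38, 79)]),
  ([(7, 128), (10, 153), (11, 89), (12, 171), (13, 96), (14, 148), (15, 42), (16, 49), (17, 75),
  (18, 136), (20, 107), (21, 123), (23, 164), (24, 160), (25, 104), (26, 106), (28, 131),
  (29, 150), (30, 117), (32, 141), (33, 137), (34, 112), (35, 143), (36, 119), (37, 43),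
  (38, 86), (39, 76), (40, 99), (44, 145), (47, 134), (48, 138), (50, 122), (51, 79), (52, 88),
  (55, 97), (56, 126), (58, 62), (59, 90), (60, 105), (61, 116), (63, 103), (64, 94), (66, 110),
  (68, 101), (69, 82), (70, 87), (71, 85), (73, 95), (74, 114), (81, 93), (84, 91)],
   [(9, 22, 111), (19, 83, 78), (27, 45, 53), (46, 8, 113), (67, 41, 77)]),
  ([(7, 100), (8, 144), (9, 173), (10, 161), (12, 158), (15, 130), (17, 136), (18, 35),
  (19, 159), (21, 165), (24, 138), (25, 126), (26, 109), (28, 127), (30, 102), (31, 112),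
  (32, 142), (33, 89), (34, 156), (36, 93), (37, 57), (38, 131), (39, 146), (40, 46), (41, 106),
  (43, 70), (44, 84), (45, 115), (49, 114), (50, 91), (51, 98), (52, 96), (54, 85), (55, 63),
  (56, 124), (62, 119), (64, 125), (65, 72), (68, 120), (75, 97), (76, 90), (78, 105), (79, 88),
  (83, 92)],
   [(11, 99, 69), (13, 47, 61), (14, 73, 67), (16, 134, 42), (20, 81, 22), (23, 48, 116),
   (27, 77, 80), (58, 59, 74), (66, 29, 82)]),
  ([(7, 104), (8, 100), (9, 130), (10, 174), (13, 147), (14, 134), (15, 102), (18, 167),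
  (21, 41), (23, 76), (24, 158), (25, 128), (26, 95), (27, 154), (29, 163), (30, 126), (33, 112),
  (37, 106), (39, 113), (40, 133), (43, 118), (46, 78), (48, 129), (50, 138), (52, 116),
  (55, 82), (56, 131), (58, 77), (61, 96), (63, 79), (64, 115), (69, 93), (71, 75), (72, 98),
  (73, 92), (74, 101), (81, 109), (83, 97), (88, 103)],
   [(11, 57, 87), (12, 16, 150), (17, 90, 86), (19, 34, 36), (20, 120, 49), (31, 94, 47),
   (32, 91, 60), (35, 114, 45), (42, 38, 84), (44, 22, 105), (54, 65, 67), (59, 51, 85)]),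
  ([(7, 114), (8, 179), (9, 124), (10, 135), (12, 153), (13, 176), (14, 163), (15, 136),
  (16, 84), (17, 143), (19, 172), (21, 152), (23, 147), (25, 161), (26, 129), (27, 154),
  (28, 141), (29, 115), (33, 162), (34, 123), (35, 158), (36, 120), (37, 159), (38, 45),
  (40, 140), (41, 89), (42, 97), (43, 107), (44, 94), (46, 91), (47, 54), (49, 57), (50, 81),
  (51, 67), (55, 127), (58, 74), (60, 111), (61, 88), (64, 78), (66, 80), (68, 117), (70, 122),
  (71, 112), (75, 109), (76, 90), (79, 99), (82, 92), (85, 103), (86, 108), (87, 110)],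
   [(11, 102, 62), (18, 59, 39), (20, 32, 96), (22, 31, 73), (30, 63, 105), (48, 24, 95),
   (56, 69, 65)]),
  ([(7, 146), (10, 56), (11, 150), (12, 144), (13, 130), (14, 163), (15, 176), (16, 72),
  (18, 118), (20, 108), (21, 166), (22, 168), (23, 71), (24, 171), (25, 77), (26, 85), (27, 46),
  (28, 107), (29, 103), (30, 134), (31, 170), (32, 55), (34, 139), (36, 113), (37, 120),
  (38, 100), (39, 155), (40, 141), (41, 137), (42, 110), (43, 104), (44, 140), (45, 154),
  (47, 122), (48, 97), (49, 68), (52, 127), (53, 109), (54, 129), (57, 115), (58, 90), (59, 133),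
  (60, 63), (65, 124), (67, 126), (69, 116), (74, 106), (76, 121), (78, 80), (79, 119), (81, 93),
  (82, 114), (83, 105), (86, 96), (91, 95)],
   [(8, 84, 75), (9, 89, 62), (19, 51, 61), (33, 17, 125), (35, 64, 101)]),
  ([(7, 83), (9, 186), (11, 179), (13, 98), (15, 120), (16, 93), (17, 79), (18, 128), (19, 151),
  (20, 168), (21, 150), (22, 155), (23, 78), (27, 137), (28, 172), (29, 85), (30, 77), (31, 87),
  (33, 75), (34, 76), (35, 145), (36, 89), (38, 131), (39, 163), (40, 158), (41, 156), (42, 100),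
  (44, 88), (45, 115), (46, 138), (47, 152), (48, 143), (49, 74), (50, 91), (52, 126), (53, 134),
  (55, 81), (56, 119), (59, 95), (60, 84), (61, 104), (63, 129), (65, 97), (66, 117), (67, 99),
  (68, 105), (69, 113), (70, 133), (71, 82), (72, 121)],
   [(8, 149, 32), (10, 130, 64), (12, 80, 14), (24, 103, 58), (25, 122, 54), (26, 86, 62),
   (37, 102, 57), (43, 73, 51)]),
  ([(7, 189), (8, 177), (9, 91), (13, 99), (15, 95), (16, 103), (18, 84), (19, 108), (20, 144),
  (22, 178), (24, 156), (25, 88), (26, 142), (27, 98), (28, 86), (29, 166), (30, 176), (31, 167),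
  (33, 89), (35, 155), (38, 146), (39, 81), (40, 77), (42, 87), (46, 85), (49, 74), (50, 149),
  (51, 152), (52, 109), (53, 80), (54, 82), (55, 83), (57, 90), (58, 76), (59, 143), (60, 94),
  (63, 128), (64, 106), (65, 139), (66, 116), (67, 105), (68, 124), (69, 96), (72, 107), (73, 78)],
   [(10, 150, 37), (11, 93, 44), (12, 159, 34), (14, 121, 48), (17, 101, 56), (21, 132, 41),
   (23, 92, 71), (32, 130, 45), (36, 75, 70), (43, 97, 61), (47, 79, 62)]),
  ([(8, 77), (9, 101), (10, 190), (11, 131), (12, 196), (13, 98), (14, 191), (15, 186),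
  (16, 164), (17, 97), (18, 167), (20, 156), (22, 78), (23, 92), (25, 79), (28, 90), (29, 173),
  (32, 152), (33, 170), (34, 153), (35, 160), (38, 166), (39, 87), (40, 154), (41, 82),
  (42, 155), (43, 129), (45, 124), (46, 88), (49, 128), (51, 107), (52, 99), (53, 94), (54, 83),
  (55, 133), (56, 80), (57, 84), (58, 140), (62, 119), (63, 81), (64, 86), (65, 103), (66, 117),
  (67, 76), (69, 93), (72, 127), (73, 116), (74, 105)],
   [(7, 89, 24), (19, 106, 68), (21, 109, 48), (26, 95, 44), (27, 132, 50), (30, 108, 37),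
   (31, 91, 70), (36, 112, 59), (47, 102, 61), (60, 75, 71)]),
  ([(7, 106), (8, 119), (9, 84), (10, 123), (11, 170), (12, 82), (13, 78), (14, 192), (15, 194),
  (16, 80), (17, 100), (18, 166), (19, 110), (20, 88), (21, 138), (22, 104), (23, 152),
  (24, 107), (25, 179), (26, 164), (28, 180), (29, 76), (30, 158), (31, 81), (32, 161),
  (33, 178), (35, 128), (36, 151), (39, 168), (40, 173), (41, 89), (42, 154), (43, 124),
  (44, 155), (45, 103), (46, 79), (48, 153), (50, 85), (52, 150), (53, 147), (55, 87), (56, 139),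
  (57, 77), (58, 140), (59, 118), (61, 121), (62, 141), (63, 86), (64, 98), (65, 95), (66, 144),
  (67, 90), (68, 97), (69, 122), (70, 115), (71, 101), (72, 114), (73, 116), (74, 102)],
   [(27, 109, 47), (34, 111, 60), (37, 83, 49), (38, 99, 75), (51, 92, 54)]),
  ([(7, 92), (8, 98), (9, 104), (10, 97), (11, 165), (12, 174), (13, 164), (14, 89), (15, 200),
  (17, 191), (18, 93), (19, 90), (20, 124), (21, 149), (23, 91), (24, 84), (25, 102), (26, 179),
  (27, 167), (28, 156), (29, 160), (30, 169), (32, 101), (33, 178), (34, 86), (36, 161),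
  (37, 100), (38, 166), (40, 81), (41, 77), (42, 138), (43, 139), (44, 82), (45, 87), (46, 163),
  (47, 110), (48, 168), (49, 153), (51, 95), (52, 78), (53, 128), (55, 151), (56, 145),
  (57, 116), (58, 134), (59, 96), (60, 94), (62, 85), (63, 125), (64, 119), (65, 122), (66, 129),
  (68, 135), (69, 79), (70, 115), (71, 88), (73, 117), (74, 140), (75, 123), (76, 131)],
   [(16, 142, 54), (22, 83, 67), (31, 112, 50), (35, 136, 39), (61, 80, 72)]),
  ([(7, 85), (9, 141), (11, 197), (12, 202), (13, 152), (14, 203), (15, 201), (16, 93), (17, 79),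
  (19, 89), (21, 189), (22, 104), (23, 78), (24, 86), (25, 175), (27, 90), (28, 100), (29, 91),
  (30, 143), (31, 98), (33, 159), (34, 170), (35, 83), (36, 148), (37, 158), (39, 151),
  (40, 147), (41, 99), (42, 157), (43, 82), (44, 162), (46, 87), (47, 84), (48, 123), (49, 97),
  (50, 119), (51, 167), (52, 80), (53, 115), (55, 111), (56, 138), (57, 134), (59, 139),
  (60, 95), (61, 113), (62, 102), (63, 156), (64, 122), (65, 144), (66, 130), (67, 94), (68, 81),
  (69, 114), (70, 145), (71, 136), (72, 105), (73, 103), (74, 107), (75, 88), (76, 112),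
  (77, 135)],
   [(8, 185, 20), (10, 127, 45), (18, 106, 54), (26, 116, 38), (32, 121, 58)]),
  ([(7, 186), (9, 106), (10, 154), (11, 196), (12, 187), (13, 92), (14, 86), (16, 104),
  (18, 201), (19, 189), (21, 87), (22, 89), (23, 171), (25, 185), (26, 191), (27, 91), (29, 168),
  (31, 98), (33, 146), (34, 96), (35, 84), (36, 169), (37, 94), (40, 83), (44, 167), (45, 90),
  (46, 81), (47, 112), (48, 172), (49, 166), (50, 138), (51, 132), (53, 142), (54, 126),
  (55, 101), (56, 85), (57, 82), (60, 103), (62, 88), (63, 97), (65, 137), (68, 110), (69, 140),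
  (70, 144), (71, 147), (73, 80), (74, 148), (75, 102), (76, 99), (77, 121)],
   [(8, 114, 78), (15, 134, 72), (17, 107, 66), (20, 93, 52), (24, 128, 30), (28, 133, 43),
   (32, 125, 59), (38, 79, 64), (39, 116, 58), (41, 95, 67), (42, 109, 61)]),
  ([(7, 181), (8, 129), (9, 203), (10, 179), (12, 87), (13, 89), (15, 199), (16, 81), (17, 173),
  (18, 88), (19, 86), (20, 101), (21, 110), (22, 104), (23, 90), (24, 114), (25, 84), (26, 176),
  (27, 93), (29, 94), (30, 124), (31, 156), (32, 134), (33, 127), (34, 141), (35, 80), (36, 180),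
  (37, 172), (40, 185), (43, 103), (44, 163), (45, 168), (46, 148), (47, 108), (48, 111),
  (49, 152), (50, 136), (51, 82), (52, 165), (53, 169), (54, 95), (55, 150), (56, 118),
  (58, 139), (59, 112), (60, 107), (61, 96), (62, 83), (63, 135), (64, 98), (65, 128), (67, 116),
  (68, 147), (69, 122), (70, 91), (71, 140), (72, 132), (74, 144), (75, 125), (76, 119),
  (79, 117)],
   [(11, 153, 57), (14, 178, 28), (38, 92, 78), (39, 143, 41), (42, 100, 77), (66, 85, 73)]),
  ([(7, 85), (8, 114), (9, 175), (10, 102), (11, 170), (12, 196), (13, 211), (14, 200), (15, 93),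
  (16, 210), (17, 82), (20, 120), (21, 100), (22, 110), (24, 183), (26, 186), (27, 193),
  (28, 115), (29, 96), (32, 119), (33, 109), (34, 118), (35, 171), (36, 133), (38, 101),
  (40, 90), (42, 160), (44, 159), (45, 83), (46, 107), (47, 84), (48, 87), (49, 113), (50, 95),
  (51, 123), (52, 116), (53, 81), (54, 137), (55, 106), (57, 141), (58, 86), (59, 166),
  (60, 157), (61, 155), (62, 88), (63, 146), (64, 126), (65, 156), (66, 111), (67, 91),
  (68, 147), (69, 104), (70, 94), (71, 117), (72, 129), (74, 105), (75, 97), (76, 89), (77, 136),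
  (78, 127), (79, 103), (80, 98)],
   [(18, 167, 37), (19, 176, 23), (25, 138, 56), (30, 124, 73), (31, 149, 43), (39, 148, 41)]),
  ([(7, 201), (8, 99), (10, 220), (11, 202), (12, 127), (13, 82), (14, 101), (15, 194),
  (16, 104), (17, 93), (18, 171), (19, 112), (20, 91), (22, 92), (23, 195), (24, 158), (26, 174),
  (27, 157), (28, 116), (30, 175), (33, 192), (34, 94), (35, 83), (37, 86), (38, 102), (39, 180),
  (40, 156), (41, 85), (42, 100), (43, 109), (44, 117), (45, 105), (47, 138), (49, 155),
  (50, 119), (51, 132), (53, 134), (54, 89), (55, 122), (56, 97), (57, 121), (58, 135),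
  (60, 108), (62, 148), (65, 162), (66, 106), (67, 147), (68, 96), (69, 137), (70, 159),
  (71, 145), (72, 149), (73, 90), (74, 129), (75, 98), (76, 141), (77, 113), (78, 103), (79, 133)],
   [(9, 170, 52), (21, 176, 31), (25, 166, 32), (29, 125, 61), (36, 124, 64), (46, 84, 81),
   (48, 88, 63), (59, 87, 80)]),
  ([(9, 85), (10, 221), (11, 102), (12, 189), (13, 216), (15, 215), (17, 97), (18, 206),
  (20, 205), (21, 213), (22, 96), (23, 100), (24, 196), (25, 109), (26, 86), (27, 98), (28, 204),
  (30, 172), (31, 169), (32, 106), (33, 185), (34, 88), (36, 93), (38, 161), (40, 92), (41, 101),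
  (42, 135), (43, 111), (44, 84), (45, 182), (46, 117), (47, 156), (48, 143), (49, 126),
  (50, 89), (51, 130), (52, 115), (53, 166), (54, 155), (55, 153), (56, 108), (57, 165),
  (58, 137), (60, 116), (62, 87), (63, 127), (64, 124), (65, 105), (66, 107), (67, 95),
  (68, 144), (69, 110), (71, 121), (72, 99), (73, 120), (74, 136), (75, 83), (76, 157),
  (77, 140), (78, 145), (79, 119), (80, 103), (81, 133), (82, 146)],
   [(7, 141, 39), (8, 151, 35), (14, 90, 70), (16, 131, 37), (19, 178, 29), (59, 91, 61)]),
  ([(7, 168), (9, 181), (10, 225), (12, 95), (16, 101), (17, 103), (19, 99), (20, 174), (21, 89),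
  (22, 209), (23, 93), (24, 105), (25, 204), (26, 85), (29, 94), (30, 102), (31, 114), (32, 141),
  (33, 201), (35, 156), (36, 176), (37, 151), (38, 97), (40, 96), (41, 122), (42, 124),
  (43, 144), (44, 84), (47, 177), (48, 130), (50, 87), (51, 170), (52, 180), (53, 86), (55, 92),
  (57, 165), (58, 106), (59, 154), (60, 109), (61, 153), (62, 148), (64, 133), (65, 131),
  (66, 142), (67, 88), (69, 90), (70, 150), (73, 113), (74, 119), (75, 108), (76, 91), (78, 138),
  (79, 121), (80, 112), (81, 104), (82, 125), (83, 115)],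
   [(8, 149, 46), (11, 206, 13), (14, 146, 77), (15, 143, 68), (18, 184, 34), (27, 100, 72),
   (28, 134, 71), (39, 140, 49), (45, 126, 56), (54, 98, 63)]),
  ([(9, 216), (14, 131), (15, 99), (16, 205), (17, 104), (18, 119), (19, 217), (20, 90),
  (21, 126), (22, 118), (24, 92), (25, 190), (26, 91), (27, 196), (28, 122), (29, 210),
  (30, 163), (31, 204), (32, 195), (33, 108), (34, 172), (36, 94), (37, 112), (38, 106),
  (39, 168), (40, 182), (43, 170), (44, 184), (45, 185), (46, 102), (47, 161), (48, 178),
  (49, 103), (50, 153), (51, 186), (52, 105), (54, 129), (55, 88), (56, 176), (57, 181),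
  (58, 136), (59, 159), (60, 128), (64, 87), (65, 166), (67, 133), (68, 124), (69, 89), (70, 95),
  (71, 96), (73, 146), (74, 101), (75, 154), (76, 123), (77, 100), (79, 85), (80, 111),
  (81, 120), (83, 86), (84, 125)],
   [(7, 127, 53), (8, 107, 82), (10, 202, 12), (11, 98, 62), (13, 142, 78), (23, 139, 72),
   (35, 97, 41), (42, 93, 63), (61, 113, 66)]),
  ([(7, 219), (11, 218), (13, 123), (14, 180), (15, 93), (16, 207), (18, 94), (19, 97), (20, 98),
  (21, 181), (23, 159), (24, 212), (25, 115), (26, 91), (27, 124), (28, 196), (29, 191),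
  (30, 184), (32, 101), (33, 99), (34, 105), (35, 90), (36, 109), (37, 169), (38, 119),
  (41, 192), (42, 200), (44, 122), (45, 176), (47, 178), (48, 142), (49, 189), (50, 172),
  (52, 141), (54, 154), (57, 89), (59, 150), (60, 144), (61, 126), (63, 153), (64, 100),
  (65, 121), (67, 104), (68, 95), (71, 127), (72, 86), (73, 138), (74, 143), (75, 102),
  (76, 134), (77, 106), (78, 156), (79, 161), (80, 87), (81, 114), (82, 88), (83, 149),
  (84, 155), (85, 130)],
   [(8, 205, 22), (9, 111, 17), (10, 103, 62), (12, 185, 46), (31, 129, 70), (39, 92, 43),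
   (40, 148, 53), (51, 96, 56), (55, 107, 66), (58, 110, 69)]),
  ([(7, 89), (8, 91), (9, 105), (10, 92), (11, 223), (13, 104), (15, 88), (16, 90), (17, 219),
  (19, 174), (20, 109), (21, 179), (22, 203), (23, 134), (24, 97), (25, 207), (26, 187),
  (27, 195), (28, 205), (29, 206), (30, 171), (31, 177), (32, 120), (33, 196), (34, 154),
  (35, 110), (36, 180), (37, 127), (38, 131), (39, 124), (40, 111), (43, 197), (44, 115),
  (45, 192), (46, 93), (47, 135), (48, 94), (49, 107), (51, 95), (52, 132), (53, 175), (54, 116),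
  (55, 98), (56, 186), (57, 108), (58, 185), (59, 101), (60, 138), (61, 112), (62, 137),
  (63, 126), (67, 123), (70, 176), (71, 150), (72, 143), (73, 166), (74, 87), (75, 119),
  (76, 168), (77, 140), (78, 149), (79, 147), (80, 158), (81, 130), (82, 128), (84, 125),
  (85, 133), (86, 118)],
   [(12, 136, 66), (14, 167, 64), (18, 144, 68), (41, 100, 83), (42, 113, 65), (50, 122, 69)]),
  ([(7, 127), (9, 99), (11, 101), (12, 91), (14, 90), (15, 228), (16, 143), (17, 93), (18, 111),
  (19, 225), (20, 213), (21, 197), (22, 131), (24, 212), (25, 100), (26, 92), (27, 105),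
  (28, 98), (29, 115), (30, 199), (32, 191), (35, 180), (36, 113), (37, 209), (40, 117),
  (44, 121), (45, 203), (46, 155), (47, 89), (48, 166), (49, 146), (50, 122), (52, 182),
  (53, 187), (54, 96), (55, 141), (56, 107), (57, 135), (58, 120), (59, 95), (60, 130),
  (61, 156), (62, 170), (63, 142), (64, 152), (65, 119), (69, 114), (72, 109), (73, 116),
  (75, 145), (77, 147), (78, 124), (80, 158), (81, 160), (82, 97), (83, 88), (84, 102),
  (85, 137), (86, 140)],
   [(8, 177, 34), (10, 151, 76), (13, 175, 33), (23, 139, 68), (31, 133, 67), (38, 138, 66),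
   (39, 167, 43), (41, 128, 70), (42, 106, 87), (51, 123, 71), (74, 94, 79)]),
  ([(9, 161), (10, 241), (11, 129), (12, 227), (13, 114), (14, 121), (15, 110), (16, 101),
  (18, 93), (19, 210), (21, 166), (22, 128), (23, 154), (25, 97), (26, 205), (27, 103),
  (28, 206), (30, 217), (31, 215), (32, 167), (35, 207), (36, 200), (37, 95), (38, 214),
  (39, 124), (40, 209), (41, 133), (42, 126), (43, 195), (44, 113), (46, 96), (47, 98),
  (49, 201), (50, 198), (51, 105), (52, 180), (53, 144), (54, 172), (55, 100), (56, 181),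
  (57, 178), (58, 106), (59, 137), (60, 109), (61, 104), (62, 171), (63, 182), (64, 179),
  (65, 94), (66, 120), (67, 149), (68, 136), (69, 153), (70, 92), (71, 131), (72, 148),
  (74, 119), (75, 108), (76, 118), (77, 112), (78, 152), (79, 134), (80, 160), (81, 107),
  (82, 143), (83, 141), (84, 89), (86, 158), (87, 116), (88, 102)],
   [(7, 139, 73), (8, 91, 24), (17, 191, 20), (29, 147, 45), (33, 151, 34), (48, 90, 85)]),
  ([(8, 124), (9, 158), (12, 134), (14, 160), (16, 90), (17, 136), (18, 112), (19, 121),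
  (20, 210), (21, 216), (22, 219), (23, 104), (24, 197), (25, 97), (26, 91), (27, 217),
  (28, 105), (29, 202), (30, 203), (31, 120), (33, 96), (34, 212), (35, 156), (36, 102),
  (37, 185), (38, 161), (39, 103), (40, 171), (41, 98), (42, 209), (43, 177), (45, 208),
  (46, 172), (47, 166), (48, 200), (49, 189), (50, 113), (52, 149), (53, 175), (54, 188),
  (55, 125), (56, 108), (57, 95), (58, 187), (59, 193), (60, 194), (61, 143), (62, 173),
  (63, 186), (64, 93), (65, 190), (66, 148), (67, 176), (68, 94), (69, 100), (71, 111),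
  (72, 107), (74, 141), (75, 131), (76, 92), (78, 145), (79, 99), (80, 118), (81, 114),
  (82, 144), (83, 101), (85, 165), (86, 150), (87, 147), (88, 137), (89, 135)],
   [(7, 109, 10), (11, 159, 70), (13, 115, 77), (15, 181, 51), (32, 123, 84), (44, 110, 73)]),
  ([(8, 211), (10, 208), (12, 132), (16, 102), (17, 105), (18, 238), (19, 236), (20, 103),
  (22, 98), (23, 93), (24, 115), (26, 228), (30, 107), (31, 213), (32, 97), (33, 112), (34, 96),
  (35, 119), (36, 185), (37, 196), (39, 193), (40, 101), (41, 153), (42, 104), (44, 203),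
  (47, 126), (48, 205), (50, 138), (51, 99), (52, 134), (53, 198), (54, 189), (55, 195),
  (56, 136), (57, 109), (58, 125), (59, 163), (60, 167), (62, 177), (63, 106), (64, 165),
  (65, 114), (66, 91), (67, 92), (68, 94), (69, 135), (73, 152), (74, 178), (75, 95), (77, 164),
  (78, 180), (79, 156), (80, 110), (81, 149), (83, 143), (84, 131), (85, 117), (86, 124),
  (87, 133), (88, 128), (89, 108), (90, 111)],
   [(7, 161, 46), (9, 182, 49), (11, 140, 72), (13, 142, 45), (14, 158, 76), (15, 160, 82),
   (21, 100, 27), (25, 181, 43), (28, 171, 38), (29, 147, 70), (61, 113, 71)]),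
  ([(7, 154), (9, 93), (10, 119), (11, 210), (12, 110), (13, 118), (14, 92), (15, 97), (16, 220),
  (17, 108), (19, 241), (20, 227), (21, 107), (22, 209), (23, 206), (24, 213), (25, 117),
  (26, 159), (29, 94), (30, 198), (31, 114), (32, 224), (34, 149), (35, 204), (36, 101),
  (38, 216), (39, 124), (40, 192), (41, 95), (42, 104), (43, 152), (44, 167), (46, 196),
  (47, 168), (49, 133), (50, 134), (51, 166), (52, 186), (55, 96), (56, 203), (57, 162),
  (58, 115), (59, 135), (61, 169), (62, 103), (63, 130), (64, 141), (65, 109), (66, 177),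
  (67, 190), (68, 144), (69, 132), (71, 120), (72, 127), (76, 126), (77, 111), (78, 170),
  (79, 143), (81, 116), (82, 176), (83, 157), (84, 150), (85, 138), (86, 139), (87, 158),
  (90, 156), (91, 164)],
   [(8, 113, 27), (18, 153, 73), (28, 179, 54), (33, 181, 37), (45, 155, 53), (48, 99, 88),
   (60, 100, 89), (70, 105, 75), (74, 98, 80)]),
  ([(8, 255), (9, 237), (11, 124), (12, 94), (15, 230), (18, 223), (19, 118), (20, 100),
  (21, 156), (22, 119), (23, 183), (24, 99), (25, 200), (26, 117), (27, 109), (28, 112),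
  (29, 180), (30, 191), (32, 224), (33, 122), (35, 110), (36, 148), (38, 215), (40, 211),
  (41, 121), (43, 103), (44, 131), (46, 208), (48, 169), (50, 198), (51, 154), (52, 195),
  (53, 204), (54, 185), (55, 207), (56, 170), (57, 203), (58, 138), (60, 201), (61, 159),
  (62, 178), (63, 97), (64, 125), (66, 116), (67, 101), (68, 129), (70, 149), (71, 158),
  (72, 163), (73, 165), (74, 114), (75, 147), (76, 151), (78, 132), (79, 111), (80, 96),
  (81, 113), (82, 104), (83, 150), (84, 115), (85, 108), (86, 126), (87, 127), (88, 164),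
  (89, 139), (90, 128), (91, 152), (92, 172)],
   [(7, 98, 69), (10, 232, 17), (13, 166, 65), (14, 93, 37), (16, 157, 77), (31, 102, 59),
   (34, 153, 49), (39, 95, 47), (42, 171, 45)]),
  ([(8, 225), (9, 108), (10, 154), (11, 230), (12, 246), (13, 114), (14, 116), (15, 100),
  (17, 106), (18, 219), (19, 242), (20, 227), (21, 124), (22, 235), (24, 175), (25, 214),
  (26, 234), (27, 126), (28, 189), (29, 120), (30, 107), (33, 218), (35, 94), (36, 173),
  (37, 229), (38, 167), (39, 159), (40, 222), (41, 97), (42, 102), (43, 118), (44, 121),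
  (45, 183), (46, 221), (47, 156), (48, 158), (49, 216), (50, 132), (51, 146), (52, 133),
  (54, 195), (55, 155), (56, 170), (57, 122), (59, 148), (60, 151), (62, 202), (63, 150),
  (65, 180), (66, 187), (67, 177), (68, 95), (69, 143), (70, 99), (71, 125), (72, 191),
  (73, 113), (74, 134), (75, 181), (76, 128), (77, 171), (78, 98), (79, 141), (80, 174),
  (81, 157), (82, 110), (84, 109), (86, 166), (87, 101), (88, 135), (89, 142), (90, 160),
  (91, 152), (92, 140), (93, 147)],
   [(7, 96, 16), (23, 178, 58), (31, 131, 53), (32, 104, 64), (34, 105, 85), (61, 111, 83)]),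
  ([(8, 111), (9, 99), (10, 237), (12, 253), (13, 206), (14, 124), (16, 126), (18, 239),
  (19, 232), (21, 107), (22, 216), (23, 145), (25, 106), (26, 172), (27, 207), (28, 109),
  (29, 110), (30, 102), (31, 193), (32, 97), (33, 233), (34, 115), (35, 220), (38, 103),
  (39, 117), (40, 133), (41, 195), (42, 113), (43, 217), (44, 130), (45, 201), (47, 166),
  (49, 101), (50, 180), (52, 200), (53, 144), (54, 181), (55, 194), (57, 185), (58, 205),
  (59, 118), (61, 151), (62, 196), (63, 104), (64, 163), (65, 157), (66, 105), (68, 147),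
  (69, 140), (71, 121), (72, 114), (73, 188), (74, 125), (75, 100), (77, 134), (78, 190),
  (79, 165), (81, 95), (82, 146), (83, 187), (84, 183), (85, 158), (88, 162), (89, 152),
  (90, 135), (91, 154), (92, 170), (93, 98)],
   [(7, 120, 94), (11, 153, 76), (15, 203, 51), (17, 161, 70), (20, 96, 86), (24, 112, 48),
   (36, 143, 80), (37, 122, 67), (46, 123, 87), (56, 148, 60)]),
  ([(7, 127), (8, 120), (9, 124), (10, 252), (12, 242), (13, 257), (14, 117), (15, 240),
  (17, 118), (18, 119), (19, 224), (20, 239), (22, 130), (23, 213), (25, 114), (27, 121),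
  (28, 112), (29, 178), (30, 202), (32, 144), (33, 223), (34, 212), (35, 230), (36, 185),
  (40, 226), (41, 105), (42, 126), (43, 165), (47, 113), (48, 197), (49, 138), (50, 107),
  (51, 100), (52, 122), (53, 188), (57, 216), (58, 104), (60, 123), (61, 156), (62, 109),
  (63, 98), (64, 141), (66, 111), (67, 143), (68, 167), (69, 203), (70, 193), (72, 192),
  (73, 108), (78, 150), (80, 154), (81, 190), (82, 149), (84, 125), (86, 103), (87, 163),
  (88, 110), (90, 96), (91, 142), (92, 102), (93, 132), (94, 175), (95, 106)],
   [(11, 200, 37), (16, 166, 85), (21, 158, 89), (24, 145, 75), (26, 196, 31), (38, 115, 76),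
   (39, 97, 83), (44, 155, 59), (45, 159, 56), (46, 101, 71), (54, 116, 79), (55, 129, 77),
   (65, 99, 74)]),
  ([(7, 266), (8, 260), (10, 255), (11, 125), (12, 139), (14, 126), (15, 239), (16, 259),
  (17, 193), (18, 117), (19, 123), (20, 110), (21, 242), (22, 231), (23, 217), (24, 227),
  (25, 190), (27, 116), (28, 248), (29, 206), (30, 203), (31, 127), (32, 131), (33, 224),
  (34, 132), (35, 237), (36, 112), (37, 144), (38, 229), (39, 195), (40, 114), (43, 175),
  (45, 196), (46, 198), (48, 222), (49, 120), (50, 121), (51, 201), (52, 105), (53, 211),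
  (54, 204), (56, 100), (57, 107), (58, 216), (59, 188), (61, 115), (63, 186), (64, 150),
  (65, 109), (66, 133), (67, 189), (68, 155), (69, 152), (70, 97), (71, 172), (72, 108),
  (73, 111), (75, 102), (76, 129), (77, 149), (78, 124), (81, 165), (82, 138), (83, 178),
  (84, 161), (85, 98), (86, 101), (87, 104), (88, 137), (90, 179), (91, 122), (92, 146),
  (93, 119), (94, 103), (95, 99), (96, 113)],
   [(9, 159, 60), (13, 134, 26), (41, 141, 89), (42, 128, 80), (44, 118, 74), (47, 106, 79),
   (55, 145, 62)]),
  ([(7, 272), (9, 138), (10, 121), (11, 203), (12, 266), (15, 114), (16, 236), (17, 143),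
  (18, 127), (19, 120), (21, 170), (24, 188), (25, 230), (27, 244), (28, 108), (29, 206),
  (30, 137), (31, 117), (32, 245), (34, 106), (35, 233), (36, 193), (37, 201), (38, 123),
  (39, 141), (40, 213), (41, 219), (42, 208), (43, 227), (44, 122), (45, 204), (47, 194),
  (48, 225), (49, 177), (52, 126), (53, 222), (54, 119), (55, 144), (56, 100), (58, 207),
  (59, 157), (60, 149), (61, 200), (62, 130), (63, 118), (64, 190), (65, 169), (66, 110),
  (67, 101), (68, 189), (69, 159), (70, 162), (71, 152), (73, 175), (74, 172), (75, 183),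
  (76, 109), (77, 107), (79, 132), (80, 179), (81, 134), (82, 165), (83, 154), (84, 133),
  (85, 171), (86, 116), (87, 187), (88, 174), (89, 135), (90, 115), (91, 151), (92, 104),
  (93, 158), (94, 182), (95, 103), (96, 99), (97, 142)],
   [(8, 105, 50), (13, 98, 14), (20, 220, 23), (22, 102, 26), (33, 153, 78), (46, 164, 57),
   (51, 146, 72)])]

theorem smallFamilies_check :
    ∀ i < 14, smallFamilies[i]?.map (checkFamily 0 (3 * (i + 2))) = some true := by
  decide +kernel

/-- The 78 entries cover `16 ≤ t ≤ 93`; `94 = 5 * 16 + 14` is the first value at which the recursion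
can fall back on some `s ≥ 16`. -/
theorem initialFamilies_check :
    ∀ i < 78, initialFamilies[i]?.map (checkFamily 6 (3 * (i + 16))) = some true := by
  decide +kernel

/-! ### The recursion, between natural numbers and integers -/

theorem map_cast_Ioc_val (k N : ℕ) :
    (Finset.Ioc k N).val.map (Nat.cast : ℕ → ℤ) = (Finset.Ioc (k : ℤ) N).val := by
  refine (Multiset.Nodup.ext (Multiset.Nodup.map Nat.cast_injective (Finset.nodup _))
    (Finset.nodup _)).2 fun x => ?_
  simp only [Multiset.mem_map, Finset.mem_val, Finset.mem_Ioc]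
  constructor
  · rintro ⟨i, hi, rfl⟩
    omega
  · intro h
    exact ⟨x.toNat, by omega, by omega⟩

theorem exists_family_of_check {k N i : ℕ} {l : List (List (ℕ × ℕ) × List (ℕ × ℕ × ℕ))}
    (h : l[i]?.map (checkFamily k N) = some true) :
    ∃ (T : Multiset (ℕ × ℕ)) (Q : Multiset (ℕ × ℕ × ℕ)),
      differences T Q = (Finset.Ioc k N).val ∧ N ≤ 45 * Q.card := by
  obtain ⟨p, -, hp⟩ := Option.map_eq_some_iff.1 h
  simp only [checkFamily, Bool.and_eq_true, decide_eq_true_eq, List.all_eq_true] at hp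
  obtain ⟨⟨⟨hnd, hmem⟩, hlen⟩, hq⟩ := hp
  have hl : ((p.1.flatMap tripleDifferences ++ p.2.flatMap quadrupleDifferences : List ℕ) :
      Multiset ℕ) = (Finset.Ioc k N).val := by
    -- Pigeonhole: at least `N - k` distinct numbers in `(k, N]` must be all of them.
    refine congrArg Finset.val (Finset.eq_of_subset_of_card_le
      (s := ⟨_, Multiset.coe_nodup.2 (nodup_of_distinctFrom _ _ hnd).1⟩)
      (fun d hd => Finset.mem_Ioc.2 (hmem d hd)) ?_)
    rw [Nat.card_Ioc]
    exact hlen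
  exact ⟨p.1, p.2, by rw [differences_coe, hl], by simpa using hq⟩

theorem exists_int_family {k N : ℕ} {T : Multiset (ℕ × ℕ)} {Q : Multiset (ℕ × ℕ × ℕ)}
    (h : differences T Q = (Finset.Ioc k N).val) (hq : N ≤ 45 * Q.card) :
    ∃ (T : Multiset (ℤ × ℤ)) (Q : Multiset (ℤ × ℤ × ℤ)),
      differences T Q = (Finset.Ioc (k : ℤ) N).val ∧ N ≤ 45 * Q.card := by
  refine ⟨_, _, (differences_map (Nat.castAddMonoidHom ℤ) T Q).trans ?_, by simpa using hq⟩
  rw [h]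
  exact map_cast_Ioc_val k N

/-- For every `t ≥ 16`, the numbers `7, …, 3 * t` are the differences of a family of triples and
quadruples with sufficiently many quadruples. -/
theorem exists_family_Ioc_six (t : ℕ) (ht : 16 ≤ t) :
    ∃ (T : Multiset (ℤ × ℤ)) (Q : Multiset (ℤ × ℤ × ℤ)),
      differences T Q = (Finset.Ioc (6 : ℤ) (3 * t : ℕ)).val ∧ 3 * t ≤ 45 * Q.card := by
  induction t using Nat.strong_induction_on with
  | _ t ih =>
    rcases lt_or_ge t 94 with hlt | hge
    · have := initialFamilies_check (t - 16) (by omega)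
      rw [Nat.sub_add_cancel ht] at this
      obtain ⟨T, Q, h, hq⟩ := exists_family_of_check this
      exact_mod_cast exists_int_family h hq
    · obtain ⟨s, i, hi, rfl⟩ : ∃ s i, i < 5 ∧ t = 5 * s + i + 14 :=
        ⟨(t - 14) / 5, (t - 14) % 5, Nat.mod_lt _ (by norm_num), by omega⟩
      obtain ⟨T, Q, h, hq⟩ := ih s (by omega) (by omega)
      obtain ⟨T₁, Q₁, hc₁, h₁⟩ := exists_inflate T Q
      -- Here `L = 15s + 2` is the largest difference of the inflated family, so the extension
      -- continues without a gap.
      obtain ⟨T₂, Q₂, hc₂, h₂⟩ := exists_extension i hi (5 * (3 * s : ℕ) + 2)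
      rw [h, Ioc_bind_Icc] at h₁
      -- The quadruple counts add up: `s ≤ 15|Q|` gives `5s ≤ 15|Q₁|` as `|Q₁| = 5|Q|`, and `i + 14
      -- ≤ 15|Q₂|`.
      refine ⟨T₁ + T₂, Q₁ + Q₂, ?_, by rw [Multiset.card_add]; omega⟩
      have e₁ := Ioc_val_add 6 32 (5 * (3 * s : ℕ) + 2) (by norm_num) (by omega)
      have e₂ := Ioc_val_add 6 (5 * (3 * s : ℕ) + 2) (3 * (5 * s + i + 14) : ℕ) (by omega)
        (by omega)
      have e₃ : (5 * (3 * s : ℕ) + 2 + (40 + 3 * i : ℕ) : ℤ) = (3 * (5 * s + i + 14) : ℕ) := by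
        push_cast
        ring
      rw [differences_add, h₁, h₂, e₃, ← e₂, ← e₁]
      norm_num
      abel

/-- Inflation shifts gaps by negative constants and so works over `ℤ`. Each gap of a block is one of
its differences, hence positive here, and `Int.toNat` loses nothing. -/
theorem exists_nat_family {N : ℕ} {T : Multiset (ℤ × ℤ)} {Q : Multiset (ℤ × ℤ × ℤ)}
    (h : differences T Q = (Finset.Ioc (0 : ℤ) N).val) :
    ∃ (T' : Multiset (ℕ × ℕ)) (Q' : Multiset (ℕ × ℕ × ℕ)),
      differences T' Q' = (Finset.Ioc 0 N).val ∧ Q'.card = Q.card := by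
  have hmem : ∀ x ∈ differences T Q, ((x.toNat : ℕ) : ℤ) = x := fun x hx => by
    rw [h] at hx
    exact Int.toNat_of_nonneg (Finset.mem_Ioc.1 (Finset.mem_val.mp hx)).1.le
  have hT : (T.map fun p => (p.1.toNat, p.2.toNat)).map
      (fun p => ((p.1 : ℤ), (p.2 : ℤ))) = T := by
    rw [Multiset.map_map]
    refine (Multiset.map_congr rfl fun p hp => ?_).trans (Multiset.map_id T)
    have hp' : ∀ x ∈ tripleDifferences p, x ∈ differences T Q := fun x hx =>
      Multiset.mem_add.2 (Or.inl (Multiset.mem_bind.2 ⟨p, hp, hx⟩))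
    have h₁ := hmem _ (hp' p.1 (by simp [tripleDifferences]))
    have h₂ := hmem _ (hp' p.2 (by simp [tripleDifferences]))
    simp only [Function.comp_apply, id, h₁, h₂]
  have hQ : (Q.map fun p => (p.1.toNat, p.2.1.toNat, p.2.2.toNat)).map
      (fun p => ((p.1 : ℤ), (p.2.1 : ℤ), (p.2.2 : ℤ))) = Q := by
    rw [Multiset.map_map]
    refine (Multiset.map_congr rfl fun p hp => ?_).trans (Multiset.map_id Q)
    have hp' : ∀ x ∈ quadrupleDifferences p, x ∈ differences T Q := fun x hx =>
      Multiset.mem_add.2 (Or.inr (Multiset.mem_bind.2 ⟨p, hp, hx⟩))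
    have h₁ := hmem _ (hp' p.1 (by simp [quadrupleDifferences]))
    have h₂ := hmem _ (hp' p.2.1 (by simp [quadrupleDifferences]))
    have h₃ := hmem _ (hp' p.2.2 (by simp [quadrupleDifferences]))
    simp only [Function.comp_apply, id, h₁, h₂, h₃]
  refine ⟨T.map fun p => (p.1.toNat, p.2.toNat),
    Q.map fun p => (p.1.toNat, p.2.1.toNat, p.2.2.toNat), ?_,
      Multiset.card_map _ _⟩
  refine Multiset.map_injective Nat.cast_injective
    (?_ : Multiset.map (Nat.castAddMonoidHom ℤ) _ = _)
  rw [← differences_map]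
  refine (congrArg₂ differences hT hQ).trans ?_
  rw [h]
  exact (map_cast_Ioc_val 0 N).symm

/-- For every `t ≥ 2`, the numbers `1, …, 3 * t` are the differences of a family of triples and
quadruples with sufficiently many quadruples. -/
theorem exists_family (t : ℕ) (ht : 2 ≤ t) :
    ∃ (T : Multiset (ℕ × ℕ)) (Q : Multiset (ℕ × ℕ × ℕ)),
      differences T Q = (Finset.Ioc 0 (3 * t)).val ∧ t ≤ 15 * Q.card := by
  rcases lt_or_ge t 16 with hlt | hge
  · have := smallFamilies_check (t - 2) (by omega)
    rw [Nat.sub_add_cancel ht] at this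
    obtain ⟨T, Q, h, hq⟩ := exists_family_of_check this
    exact ⟨T, Q, h, by omega⟩
  · obtain ⟨T, Q, h, hq⟩ := exists_family_Ioc_six t hge
    -- The gaps `(1, 3, 2)` describe the perfect ruler `0, 1, 4, 6`, whose differences are the
    -- missing `1, …, 6`.
    have h' : differences (0 + T) ({(1, 3, 2)} + Q) =
        (Finset.Ioc (0 : ℤ) (3 * t : ℕ)).val := by
      rw [differences_add, h, ← Ioc_val_add 0 6 (3 * t : ℕ) (by norm_num) (by omega)]
      congr 1
      decide
    obtain ⟨T', Q', h'', hcard⟩ := exists_nat_family h'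
    refine ⟨T', Q', h'', ?_⟩
    rw [hcard, Multiset.card_add]
    omega

end Families

/-! ### The counting bound for codes -/

section Codes

theorem card_positionPairs (X : Finset ℕ) : (positionPairs X).card = X.card.choose 2 := by
  induction X using Finset.induction_on_max with
  | empty => simp [positionPairs]
  | insert m X hm ih =>
    have hmX : m ∉ X := fun h => lt_irrefl _ (hm m h)
    have hunion : positionPairs (insert m X) = positionPairs X ∪ X.image fun x => (x, m) := by
      ext ⟨x, y⟩
      simp only [positionPairs, Finset.mem_filter, Finset.mem_product, Finset.mem_insert,
        Finset.mem_union, Finset.mem_image, Prod.mk.injEq]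
      constructor
      · rintro ⟨⟨rfl | hx, rfl | hy⟩, hlt⟩
        · omega
        · have := hm y hy
          omega
        · exact Or.inr ⟨x, hx, rfl, rfl⟩
        · exact Or.inl ⟨⟨hx, hy⟩, hlt⟩
      · rintro (⟨⟨hx, hy⟩, hlt⟩ | ⟨z, hz, rfl, rfl⟩)
        · exact ⟨⟨Or.inr hx, Or.inr hy⟩, hlt⟩
        · exact ⟨⟨Or.inr hz, Or.inl rfl⟩, hm z hz⟩
    have hdisj : Disjoint (positionPairs X) (X.image fun x => (x, m)) := by
      refine Finset.disjoint_left.2 fun p hp hp' => ?_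
      obtain ⟨z, -, rfl⟩ := Finset.mem_image.1 hp'
      exact hmX (Finset.mem_product.1 (Finset.mem_filter.1 hp).1).2
    rw [hunion, Finset.card_union_of_disjoint hdisj, ih,
      Finset.card_image_of_injective _ fun x y h => (Prod.mk.injEq _ _ _ _ ▸ h).1,
      Finset.card_insert_of_notMem hmX, Nat.choose_succ_succ' _ 1, Nat.choose_one_right, add_comm]

/-- `auto` and `cross` together say that the slot distance is injective on the pairs of all
codewords taken disjointly; its values lie in `{0, …, D}`, which has `D + 1` elements. -/
theorem IsSOOC.sum_card_positionPairs_le {n r : ℕ} {w : Fin r → ℕ} {q : Fin r → ℚ}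
    {C : Finset (Finset ℕ)} (h : IsSOOC n w q C) :
    ∑ X ∈ C, (positionPairs X).card ≤ maxSlotDistance C + 1 := by
  rw [← Finset.card_sigma, ← Finset.card_range (maxSlotDistance C + 1)]
  refine Finset.card_le_card_of_injOn (fun x => slotDistance x.2) ?_ ?_
  · rintro ⟨X, p⟩ hx
    obtain ⟨hX, hp⟩ := Finset.mem_sigma.1 hx
    refine Finset.mem_coe.2 (Finset.mem_range.2 (Nat.lt_succ_of_le ?_))
    exact (Finset.le_sup (f := slotDistance) hp).trans
      (Finset.le_sup (f := fun X => (positionPairs X).sup slotDistance) hX)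
  · rintro ⟨X, p⟩ hx ⟨Y, p'⟩ hy hxy
    obtain ⟨hX, hp⟩ := Finset.mem_sigma.1 (Finset.mem_coe.1 hx)
    obtain ⟨hY, hp'⟩ := Finset.mem_sigma.1 (Finset.mem_coe.1 hy)
    by_cases hXY : X = Y
    · subst hXY
      by_cases hpp : p = p'
      · rw [hpp]
      · exact absurd hxy (h.auto X hX p hp p' hp' hpp)
    · exact absurd hxy (h.cross X hX Y hY hXY p hp p' hp')

/-- The bound of the length of a code with weights `3` and `4` by its number of codewords. -/
theorem IsSOOC.card_mul_le {n : ℕ} {θ : ℚ} {C : Finset (Finset ℕ)}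
    (h : IsSOOC n ![3, 4] ![1 - θ, θ] C) : (6 + 6 * θ) * C.card + 1 ≤ n := by
  have hC : (C.card : ℚ) ≠ 0 := by
    exact_mod_cast (Finset.card_pos.2 h.nonempty).ne'
  have h₃ : ((C.filter fun X => X.card = 3).card : ℚ) / C.card = 1 - θ := h.distribution 0
  have h₄ : ((C.filter fun X => X.card = 4).card : ℚ) / C.card = θ := h.distribution 1
  rw [div_eq_iff hC] at h₃ h₄
  have hsum : ∑ X ∈ C, (positionPairs X).card =
      3 * (C.filter fun X => X.card = 3).card + 6 * (C.filter fun X => X.card = 4).card := by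
    rw [Finset.card_filter, Finset.card_filter, Finset.mul_sum, Finset.mul_sum,
      ← Finset.sum_add_distrib]
    refine Finset.sum_congr rfl fun X hX => ?_
    rw [card_positionPairs]
    obtain ⟨i, hi⟩ := h.weight X hX
    fin_cases i
    · simp at hi
      simp [hi]
    · simp at hi
      simp [hi, Nat.choose]
  have hle := h.sum_card_positionPairs_le
  -- `strict` reads `2 * (D + 1) + 1 ≤ n`, and `D + 1` bounds the number of pairs.
  have hn : (2 * (3 * (C.filter fun X => X.card = 3).card +
      6 * (C.filter fun X => X.card = 4).card) + 1 : ℚ) ≤ n := by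
    have := h.strict
    exact_mod_cast (by omega)
  rw [h₃, h₄] at hn
  linarith

/-! ### From difference families to codes -/

/-- The differences of the pairs of positions of ones of `X`. -/
def positionDifferences (X : Finset ℕ) : Multiset ℕ :=
  (positionPairs X).val.map fun p => p.2 - p.1

theorem slotDistance_add_one {X : Finset ℕ} {p : ℕ × ℕ} (hp : p ∈ positionPairs X) :
    slotDistance p + 1 = p.2 - p.1 := by
  have := (Finset.mem_filter.1 hp).2
  unfold slotDistance
  omega

theorem mem_positionDifferences {X : Finset ℕ} {p : ℕ × ℕ} (hp : p ∈ positionPairs X) :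
    slotDistance p + 1 ∈ positionDifferences X :=
  slotDistance_add_one hp ▸ Multiset.mem_map_of_mem _ hp

theorem positionDifferences_triple {a b : ℕ} (ha : 0 < a) (hb : 0 < b) :
    positionDifferences {0, a, a + b} = (tripleDifferences (a, b) : Multiset ℕ) := by
  have h : positionPairs {0, a, a + b} = {(0, a), (a, a + b), (0, a + b)} := by
    ext ⟨x, y⟩
    simp only [positionPairs, Finset.mem_filter, Finset.mem_product, Finset.mem_insert,
      Finset.mem_singleton, Prod.mk.injEq]
    omega
  rw [positionDifferences, h, Finset.insert_val_of_notMem, Finset.insert_val_of_notMem]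
  · simp [tripleDifferences, ← Multiset.cons_coe]
  · simp [ha.ne']
  · simp [ha.ne, hb.ne']

theorem positionDifferences_quadruple {a b c : ℕ} (ha : 0 < a) (hb : 0 < b) (hc : 0 < c) :
    positionDifferences {0, a, a + b, a + b + c} =
      (quadrupleDifferences (a, b, c) : Multiset ℕ) := by
  have h : positionPairs {0, a, a + b, a + b + c} =
      {(0, a), (a, a + b), (a + b, a + b + c), (0, a + b), (a, a + b + c), (0, a + b + c)} := by
    ext ⟨x, y⟩
    simp only [positionPairs, Finset.mem_filter, Finset.mem_product, Finset.mem_insert,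
      Finset.mem_singleton, Prod.mk.injEq]
    omega
  rw [positionDifferences, h, Finset.insert_val_of_notMem, Finset.insert_val_of_notMem,
    Finset.insert_val_of_notMem, Finset.insert_val_of_notMem, Finset.insert_val_of_notMem]
  · simp [quadrupleDifferences, ← Multiset.cons_coe, add_assoc]
    omega
  all_goals
    simp only [Finset.mem_insert, Finset.mem_singleton, Prod.mk.injEq]
    omega

/-- A repeated element would contribute its nonempty image twice. It shows that different blocks
give different codewords, so that they form a `Finset`. -/
theorem nodup_of_nodup_bind {α β : Type*} {s : Multiset α} {f : α → Multiset β}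
    (hf : ∀ a ∈ s, f a ≠ 0) (h : (s.bind f).Nodup) : s.Nodup := by
  refine Multiset.nodup_iff_ne_cons_cons.2 fun a t hs => ?_
  obtain ⟨x, hx⟩ := Multiset.exists_mem_of_ne_zero (hf a (by simp [hs]))
  rw [hs, Multiset.cons_bind, Multiset.cons_bind, ← add_assoc, Multiset.nodup_add,
    Multiset.nodup_add] at h
  exact Multiset.disjoint_left.1 h.1.2.2 hx hx

/-- The right side has no repetitions, which gives `auto` within a summand of the `bind` and `cross`
between two summands. Slot distances are differences minus one, so `D ≤ N - 1` and `2 * D + 3 ≤ 2 *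
N + 1`. -/
theorem isSOOC_of_bind_eq {n N r : ℕ} {w : Fin r → ℕ} {q : Fin r → ℚ} {C : Finset (Finset ℕ)}
    (hbind : C.val.bind positionDifferences = (Finset.Ioc 0 N).val) (hN : 0 < N)
    (hn : 2 * N + 1 ≤ n) (hlen : ∀ X ∈ C, X ⊆ Finset.range n)
    (hw : ∀ X ∈ C, ∃ i, X.card = w i)
    (hq : ∀ i, ((C.filter fun X => X.card = w i).card : ℚ) / (C.card : ℚ) = q i) :
    IsSOOC n w q C where
  nonempty := by
    rw [Finset.nonempty_iff_ne_empty]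
    rintro rfl
    have : N ∈ (Finset.Ioc 0 N).val := Finset.mem_Ioc.2 ⟨hN, le_rfl⟩
    simp [← hbind] at this
  length := hlen
  weight := hw
  distribution := hq
  auto X hX p hp p' hp' hne heq := by
    have hnd : (positionDifferences X).Nodup :=
      (Multiset.nodup_bind.1 (hbind ▸ (Finset.Ioc 0 N).nodup)).1 X hX
    refine hne (Multiset.inj_on_of_nodup_map hnd p hp p' hp' ?_)
    rw [← slotDistance_add_one hp, ← slotDistance_add_one hp', heq]
  cross X hX Y hY hXY p hp p' hp' heq := by
    have hnd : (C.val.bind positionDifferences).Nodup := hbind ▸ (Finset.Ioc 0 N).nodup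
    obtain ⟨s, hs⟩ := Multiset.exists_cons_of_mem (show X ∈ C.val from hX)
    have hYs : Y ∈ s := by
      have : Y ∈ X ::ₘ s := hs ▸ hY
      exact (Multiset.mem_cons.1 this).resolve_left (Ne.symm hXY)
    rw [hs, Multiset.cons_bind, Multiset.nodup_add] at hnd
    refine Multiset.disjoint_left.1 hnd.2.2 (mem_positionDifferences hp) ?_
    rw [heq]
    exact Multiset.mem_bind.2 ⟨Y, hYs, mem_positionDifferences hp'⟩
  strict := by
    have : maxSlotDistance C ≤ N - 1 := by
      refine Finset.sup_le fun X hX => Finset.sup_le fun p hp => ?_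
      have : slotDistance p + 1 ∈ (Finset.Ioc 0 N).val :=
        hbind ▸ Multiset.mem_bind.2 ⟨X, hX, mem_positionDifferences hp⟩
      have := (Finset.mem_Ioc.1 (Finset.mem_val.mp this)).2
      omega
    omega

/-- A family of triples and quadruples with differences `1, …, N` yields a perfect and optimal
code. -/
theorem exists_code {N : ℕ} (hN : 0 < N) (T : Multiset (ℕ × ℕ)) (Q : Multiset (ℕ × ℕ × ℕ))
    (h : differences T Q = (Finset.Ioc 0 N).val) :
    ∃ C : Finset (Finset ℕ),
      IsPerfectSOOC (2 * N + 1) ![3, 4]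
        ![1 - (Q.card : ℚ) / (T.card + Q.card), (Q.card : ℚ) / (T.card + Q.card)] C ∧
      IsOptimalSOOC (2 * N + 1) ![3, 4]
        ![1 - (Q.card : ℚ) / (T.card + Q.card), (Q.card : ℚ) / (T.card + Q.card)] C := by
  have hmem : ∀ x ∈ differences T Q, 0 < x ∧ x ≤ N := fun x hx => by
    rw [h] at hx
    exact Finset.mem_Ioc.1 hx
  have hT : ∀ p ∈ T, 0 < p.1 ∧ 0 < p.2 ∧ p.1 + p.2 ≤ N := fun p hp => by
    have hp' : ∀ x ∈ tripleDifferences p, x ∈ differences T Q := fun x hx =>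
      Multiset.mem_add.2 (Or.inl (Multiset.mem_bind.2 ⟨p, hp, hx⟩))
    exact ⟨(hmem _ (hp' p.1 (by simp [tripleDifferences]))).1,
      (hmem _ (hp' p.2 (by simp [tripleDifferences]))).1,
      (hmem _ (hp' (p.1 + p.2) (by simp [tripleDifferences]))).2⟩
  have hQ : ∀ p ∈ Q, 0 < p.1 ∧ 0 < p.2.1 ∧ 0 < p.2.2 ∧ p.1 + p.2.1 + p.2.2 ≤ N := fun p hp => by
    have hp' : ∀ x ∈ quadrupleDifferences p, x ∈ differences T Q := fun x hx =>
      Multiset.mem_add.2 (Or.inr (Multiset.mem_bind.2 ⟨p, hp, hx⟩))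
    exact ⟨(hmem _ (hp' p.1 (by simp [quadrupleDifferences]))).1,
      (hmem _ (hp' p.2.1 (by simp [quadrupleDifferences]))).1,
      (hmem _ (hp' p.2.2 (by simp [quadrupleDifferences]))).1,
      (hmem _ (hp' (p.1 + p.2.1 + p.2.2) (by simp [quadrupleDifferences]))).2⟩
  set W₃ : Multiset (Finset ℕ) := T.map fun p => {0, p.1, p.1 + p.2} with hW₃
  set W₄ : Multiset (Finset ℕ) :=
    Q.map fun p => {0, p.1, p.1 + p.2.1, p.1 + p.2.1 + p.2.2} with hW₄
  have hcard₃ : ∀ X ∈ W₃, X.card = 3 := fun X hX => by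
    obtain ⟨p, hp, rfl⟩ := Multiset.mem_map.1 hX
    obtain ⟨h₁, h₂, -⟩ := hT p hp
    exact Finset.card_eq_three.2 ⟨_, _, _, by omega, by omega, by omega, rfl⟩
  have hcard₄ : ∀ X ∈ W₄, X.card = 4 := fun X hX => by
    obtain ⟨p, hp, rfl⟩ := Multiset.mem_map.1 hX
    obtain ⟨h₁, h₂, h₃, -⟩ := hQ p hp
    rw [Finset.card_insert_of_notMem, Finset.card_eq_three.2 ⟨_, _, _, ?_, ?_, ?_, rfl⟩]
    · omega
    · omega
    · omega
    · simp only [Finset.mem_insert, Finset.mem_singleton]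
      omega
  have hbind : (W₃ + W₄).bind positionDifferences = (Finset.Ioc 0 N).val := by
    rw [← h, differences, Multiset.add_bind, hW₃, hW₄, Multiset.bind, Multiset.bind,
      Multiset.map_map, Multiset.map_map]
    congr 1
    · exact Multiset.bind_congr fun p hp =>
        positionDifferences_triple (hT p hp).1 (hT p hp).2.1
    · exact Multiset.bind_congr fun p hp =>
        positionDifferences_quadruple (hQ p hp).1 (hQ p hp).2.1 (hQ p hp).2.2.1
  have hnd : (W₃ + W₄).Nodup := by
    refine nodup_of_nodup_bind (f := positionDifferences) (fun X hX h0 => ?_)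
      (hbind ▸ (Finset.Ioc 0 N).nodup)
    have hX0 := congrArg Multiset.card h0
    rw [positionDifferences, Multiset.card_map, ← Finset.card_def, card_positionPairs] at hX0
    rcases Multiset.mem_add.1 hX with hX | hX
    · simp [hcard₃ X hX] at hX0
    · simp [hcard₄ X hX, Nat.choose] at hX0
  set C : Finset (Finset ℕ) := ⟨W₃ + W₄, hnd⟩ with hC
  have hCcard : C.card = T.card + Q.card := by simp [hC, hW₃, hW₄]
  have hN' : N = 3 * T.card + 6 * Q.card := by
    rw [← card_differences, h, ← Finset.card_def, Nat.card_Ioc, Nat.sub_zero]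
  have hpos : (T.card + Q.card : ℚ) ≠ 0 := by
    have : T.card + Q.card ≠ 0 := by omega
    exact_mod_cast this
  have hfilter : ∀ k, ((C.filter fun X => X.card = k).card) =
      (W₃.filter fun X => X.card = k).card + (W₄.filter fun X => X.card = k).card := fun k => by
    rw [← Multiset.card_add, ← Multiset.filter_add]
    rfl
  have hfilter₃ : (C.filter fun X => X.card = 3).card = T.card := by
    rw [hfilter, Multiset.filter_eq_self.2 hcard₃,
      Multiset.filter_eq_nil.2 fun X hX => by simp [hcard₄ X hX]]
    simp [hW₃]
  have hfilter₄ : (C.filter fun X => X.card = 4).card = Q.card := by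
    rw [hfilter, Multiset.filter_eq_self.2 hcard₄,
      Multiset.filter_eq_nil.2 fun X hX => by simp [hcard₃ X hX]]
    simp [hW₄]
  have hcode : IsSOOC (2 * N + 1) ![3, 4]
      ![1 - (Q.card : ℚ) / (T.card + Q.card), (Q.card : ℚ) / (T.card + Q.card)] C := by
    refine isSOOC_of_bind_eq hbind hN le_rfl (fun X hX => ?_) (fun X hX => ?_) (fun i => ?_)
    · rcases Multiset.mem_add.1 hX with hX | hX
      · obtain ⟨p, hp, rfl⟩ := Multiset.mem_map.1 hX
        have := hT p hp
        intro x
        simp only [Finset.mem_insert, Finset.mem_singleton, Finset.mem_range]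
        omega
      · obtain ⟨p, hp, rfl⟩ := Multiset.mem_map.1 hX
        have := hQ p hp
        intro x
        simp only [Finset.mem_insert, Finset.mem_singleton, Finset.mem_range]
        omega
    · rcases Multiset.mem_add.1 hX with hX | hX
      · exact ⟨0, hcard₃ X hX⟩
      · exact ⟨1, hcard₄ X hX⟩
    · rw [hCcard]
      fin_cases i
      · change ((C.filter fun X => X.card = 3).card : ℚ) / _ = 1 - (Q.card : ℚ) / _
        rw [hfilter₃]
        push_cast
        field_simp
        ring
      · change ((C.filter fun X => X.card = 4).card : ℚ) / _ = (Q.card : ℚ) / _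
        rw [hfilter₄]
        push_cast
        rfl
  set θ : ℚ := (Q.card : ℚ) / (T.card + Q.card) with hθ
  have hθ0 : 0 ≤ θ := by positivity
  -- Both sides equal `6|T| + 12|Q|`: the counting bound is attained. Minimal length, maximal size
  -- and the floor formula, whose quotient is the integer `|C|`, all follow from this.
  have hlength : (6 + 6 * θ) * C.card = 2 * N := by
    rw [hCcard, hN', hθ]
    push_cast
    field_simp
    ring
  refine ⟨C, ⟨hcode, fun n' C' hC' hcard => ?_⟩, hcode, fun C' hC' => ?_, ?_⟩
  · have := hC'.card_mul_le
    rw [hcard, hlength] at this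
    exact_mod_cast this
  · have := hC'.card_mul_le
    push_cast at this
    rw [← hlength] at this
    have h' : (C'.card : ℚ) ≤ C.card :=
      le_of_mul_le_mul_left (by linarith) (by positivity : (0 : ℚ) < 6 + 6 * θ)
    exact_mod_cast h'
  · have hsum : ∑ i, (![1 - θ, θ] : Fin 2 → ℚ) i * ((![3, 4] : Fin 2 → ℕ) i : ℚ) *
        (((![3, 4] : Fin 2 → ℕ) i : ℚ) - 1) = 6 + 6 * θ := by
      simp [Fin.sum_univ_two]
      ring
    rw [hsum]
    push_cast
    rw [add_sub_cancel_right, ← hlength, mul_div_cancel_left₀ _ (by positivity)]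
    simp

end Codes

theorem corollary4p6 (g : ℕ) (hg : g ≡ 1 [MOD 6]) (hg13 : 13 ≤ g) :
    ∃ θ : ℚ, 1 / 14 ≤ θ ∧ θ ≤ 1 ∧ ∃ C : Finset (Finset ℕ),
      IsPerfectSOOC g ![3, 4] ![1 - θ, θ] C ∧ IsOptimalSOOC g ![3, 4] ![1 - θ, θ] C := by
  obtain ⟨t, ht, rfl⟩ : ∃ t, 2 ≤ t ∧ g = 2 * (3 * t) + 1 := by
    unfold Nat.ModEq at hg
    exact ⟨g / 6, by omega, by omega⟩
  obtain ⟨T, Q, h, hq⟩ := exists_family t ht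
  have hcard := card_differences T Q
  rw [h, ← Finset.card_def, Nat.card_Ioc, Nat.sub_zero] at hcard
  have hpos : (0 : ℚ) < T.card + Q.card := by
    have : 0 < T.card + Q.card := by omega
    exact_mod_cast this
  refine ⟨(Q.card : ℚ) / (T.card + Q.card), ?_, ?_, exists_code (by omega) T Q h⟩
  · rw [div_le_div_iff₀ (by norm_num) hpos]
    -- From `3t = 3|T| + 6|Q|` and `t ≤ 15|Q|` comes `|T| ≤ 13|Q|`.
    have : 1 * (T.card + Q.card) ≤ Q.card * 14 := by omega
    exact_mod_cast this
  · rw [div_le_one hpos]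
    linarith [(Nat.cast_nonneg T.card : (0 : ℚ) ≤ T.card)]
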